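/- Call $(P_n)_{n\ge 0}\subset\mathbb C[z]$ Laurent biorthogonal polynomials (LBP) with recurrence coefficients $(d_n)_{n\ge0}$, $(b_n)_{n\ge1}$ if $b_nd_n\ne0$ for $n\ge1$ and $$P_{n+1}(z)+d_nP_n(z)=z\bigl(P_n(z)+b_nP_{n-1}(z)\bigr)\quad(n\ge0),\qquad P_{-1}=0,\ P_0=1 .$$ Call them reciprocal invariant if $z^nP_n(1/z)=P_n(z)$ for all $n\ge0$ and $z\neq0$. (1) LBP are reciprocal invariant if and only if $d_n=-1$ for all $n\ge0$. In this case there is exactly one sequence of polynomials $S_n$ with $S_n(x)=z^{-n/2}P_n(z)$, $x=z^{1/2}+z^{-1/2}$, for all $z\ne0$ and both choices of the square root; each $S_n$ is monic of degree $n$, and $S_{n+1}(x)+u_nS_{n-1}(x)=xS_n(x)$ with $u_n=-b_n$, $S_{-1}=0$, $S_0=1$. (2) Let the polynomials $A_n(z)$ be given by $(2n+1)A_n-2n(1+z)A_{n-1}+(2n-1)zA_{n-2}=0$ for $n\ge1$, $A_{-1}=0$, $A_0=1$, and let $P_n=A_n/\xi_n$ with $\xi_n=n!/(3/2)_n$ (the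 Hermite elliptic LBP). Then the $P_n$ are reciprocal invariant LBP with $d_n=-1$ and $b_n=-\frac{(n+1/2)^2}{n(n+1)}$, and $P_n(1)\neq 0$ for all $n$. Let $S_n$ be the monic real polynomials of degree $n$ determined by $S_n(x)=z^{-n/2}P_n(z)$, $x=z^{1/2}+z^{-1/2}$. Then: (a) With $U_n=P_{n+1}(1)/P_n(1)$, $\tilde P_n(z)=\frac{P_{n+1}(z)-U_nP_n(z)}{z-1}$ and $a_{n-1}=-\tilde P_n(0)$ one has $a_{n-1}\ne1$ and $$S_n(x)=\frac{z^{-n/2}\bigl(\tilde P_n(z)+z^n\tilde P_n(1/z)\bigr)}{1-a_{n-1}}\qquad(n\ge0).$$ (b) $S_{n+1}(x)+u_nS_{n-1}(x)=xS_n(x)$ with $u_n=\frac{(n+1/2)^2}{n(n+1)}$, $S_{-1}=0$, $S_0=1$. Thus the $S_n$ are the monic associated Legendre polynomials (normalised to $[-2,2]$), whose recurrence coefficients are $u_n=\frac{(n+\nu)^2}{(n+\nu)^2-1/4}$, with $\nu=1/2$. They are symmetric: $S_n(-x)=(-1)^nS_n(x)$. (c) Let $K(k)=\int_0^1\frac{dt}{\sqrt{(1-t^2)(1-k^2t^2)}}$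 and $$w(x)=\frac{2}{K^2\bigl(\sqrt{1/2+x/4}\bigr)+K^2\bigl(\sqrt{1/2-x/4}\bigr)},\qquad -2<x<2 .$$ Then $w$ is even and positive on $(-2,2)$, and the $S_n$ are orthogonal on $[-2,2]$ with weight $w$: all the integrals converge and $\int_{-2}^{2}S_n(x)S_m(x)w(x)\,dx=h_n\delta_{nm}$ with $h_n>0$. -/

import Mathlib

open Polynomial

noncomputable section

/-- Laurent biorthogonal polynomials with recurrence coefficients `d n` (`n ≥ 0`) and
`b n` (`n ≥ 1`; the value `b 0` plays no role, since `P_{-1} = 0`): the polynomials given by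
`P_{-1} = 0`, `P_0 = 1`, `P_{n+1} + d_n P_n = z (P_n + b_n P_{n-1})`, under the
nondegeneracy condition `b_n d_n ≠ 0` for `n ≥ 1`. -/
structure IsLBP {R : Type*} [Field R] (d b : ℕ → R) (P : ℕ → R[X]) : Prop where
  nondegenerate : ∀ n : ℕ, 1 ≤ n → b n * d n ≠ 0
  init : P 0 = 1
  rec_zero : P 1 + C (d 0) * P 0 = X * P 0
  rec_succ : ∀ n : ℕ,
    P (n + 2) + C (d (n + 1)) * P (n + 1) = X * (P (n + 1) + C (b (n + 1)) * P n)

/-- Reciprocal invariance: `z^n P_n(1/z) = P_n(z)` for all `n`. -/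
def IsReciprocalInvariant {R : Type*} [Field R] [Algebra R ℂ] (P : ℕ → R[X]) : Prop :=
  ∀ (n : ℕ) (z : ℂ), z ≠ 0 → z ^ n * aeval (1 / z) (P n) = aeval z (P n)

/-- `S_n(x) = z^{-n/2} P_n(z)` with `x = z^{1/2} + z^{-1/2}`, for every nonzero complex `z` and
either choice `s` of the square root `z^{1/2}`. -/
def IsSymmetrization {R : Type*} [Field R] [Algebra R ℂ] (P S : ℕ → R[X]) : Prop :=
  ∀ (n : ℕ) (z s : ℂ), z ≠ 0 → s ^ 2 = z → aeval (s + s⁻¹) (S n) = s⁻¹ ^ n * aeval z (P n)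

/-- The three-term recurrence `S_{n+1}(x) + u_n S_{n-1}(x) = x S_n(x)`, with `S_{-1} = 0` and
`S_0 = 1`. -/
structure IsSymmetricRecurrence {R : Type*} [Field R] (u : ℕ → R) (S : ℕ → R[X]) : Prop where
  init : S 0 = 1
  rec_zero : S 1 = X * S 0
  rec_succ : ∀ n : ℕ, S (n + 2) + C (u (n + 1)) * S n = X * S (n + 1)

/-- The monic associated Legendre polynomials with parameter `ν ≥ 0`, normalised to the interval
`[-2, 2]`: `u_n = (n + ν)^2 / ((n + ν)^2 - 1/4)`. The ordinary Legendre polynomials are `ν = 0`. -/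
def assocLegendre (ν : ℝ) : ℕ → ℝ[X]
  | 0 => 1
  | 1 => X
  | n + 2 => X * assocLegendre ν (n + 1)
      - C (((n + 1 : ℕ) + ν) ^ 2 / (((n + 1 : ℕ) + ν) ^ 2 - 1 / 4)) * assocLegendre ν n

/-- Hermite's polynomials `A_n` in the variable `z = k^2`:
`(2n+1) A_n - 2n (1+z) A_{n-1} + (2n-1) z A_{n-2} = 0` for `n ≥ 1`, `A_{-1} = 0`, `A_0 = 1`. -/
def hermiteA : ℕ → ℝ[X]
  | 0 => 1
  | 1 => C (2 / 3) * (1 + X)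
  | n + 2 => C (1 / (2 * (n : ℝ) + 5)) *
      (C (2 * ((n : ℝ) + 2)) * (1 + X) * hermiteA (n + 1)
        - C (2 * (n : ℝ) + 3) * X * hermiteA n)

/-- `ξ_n = n! / (3/2)_n`. -/
def hermiteXi (n : ℕ) : ℝ := (n.factorial : ℝ) / (ascPochhammer ℝ n).eval (3 / 2)

/-- The Hermite elliptic Laurent biorthogonal polynomials `P_n = A_n / ξ_n`. -/
def hermiteP (n : ℕ) : ℝ[X] := C (1 / hermiteXi n) * hermiteA n

/-- The Christoffel transform at the point `1`:
`(P_{n+1}(z) - U_n P_n(z)) / (z - 1)` with `U_n = P_{n+1}(1) / P_n(1)`. -/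
def christoffelOne (P : ℕ → ℝ[X]) (n : ℕ) : ℝ[X] :=
  (P (n + 1) - C ((P (n + 1)).eval 1 / (P n).eval 1) * P n) /ₘ (X - C 1)

/-- The complete elliptic integral of the first kind as a function of the modulus `k`
(`0 ≤ k < 1`). -/
def ellipticK (k : ℝ) : ℝ := ∫ t in (0 : ℝ)..1, 1 / √((1 - t ^ 2) * (1 - k ^ 2 * t ^ 2))

/-- The weight function, for `-2 < x < 2`. -/
def legendreWeight (x : ℝ) : ℝ :=
  2 / (ellipticK (√(1 / 2 + x / 4)) ^ 2 + ellipticK (√(1 / 2 - x / 4)) ^ 2)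

/-- `∫_{-2}^{2} S_n S_m w dx = h_n δ_{nm}` with `h_n > 0`; the integrals converge. -/
def IsOrthogonalOn (S : ℕ → ℝ[X]) (w : ℝ → ℝ) : Prop :=
  (∀ n m : ℕ, IntervalIntegrable (fun x => (S n).eval x * (S m).eval x * w x)
    MeasureTheory.volume (-2) 2) ∧
  ∃ h : ℕ → ℝ, (∀ n, 0 < h n) ∧
    ∀ n m : ℕ, ∫ x in (-2 : ℝ)..2, (S n).eval x * (S m).eval x * w x = if n = m then h n else 0

end

/-! Algebraic part. If `d n = -1` for all `n`, dividing the LBP recurrence by a power of `s =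
z^{1/2}` turns it into a three-term recurrence in `x = s + 1/s`. Since `x` is unchanged under `s →
1/s`, the solution makes `P` reciprocal invariant. Conversely, reflecting the recurrence and
comparing gives `(1 + d_n)(z - 1) P_n = 0`. The formula with the Christoffel transform comes from
the identity `P̃_n(z) + z^n P̃_n(1/z) = U_n P_n(z)`, where `1 - a_{n-1} = U_n`.

Orthogonality. Let `a_k` be the coefficients of `(1 - x)^{-1/2}`, and put `Q_n(w) = ∑ a_k a_{k+n}
w^k` and `V = 1/Q_0`. On `z = e^{iθ}` the functions `C_n = z^n Q_n(z²)` satisfy a real three-term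
recurrence (`legendreC_rec`), so `C_{n+1} = ξ_n S_n(2 cos θ) C_1 + r_n C_0` with `r_n` real
(`legendreC_succ_eq`). The Casoratian `(2n+1) Im(C_{n+1} conj C_n)` does not depend on `n`; its
limit, found from Wallis' product, is `1/π` (`im_legendreC_one_mul_conj`). As `V C_0 = 1` on the
circle, `S_n(2 cos θ) |V|² sin θ` is, up to a positive constant, the real part of `z^n (1 - z²)
Q_{n+1}(z²) V(z²)` (`re_legendre_boundary`). That function is holomorphic in the disc, continuous up
to the circle and, for `n ≥ 1`, zero at the origin, so its mean vanishes. Thus `S_n` is orthogonal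
to `1` for the weight `|V|² sin θ dθ`, and the recurrence extends this to all pairs
(`IsSymmetricRecurrence.functional_eq_zero`).

Boundary regularity comes from coefficients: `(1 - w) Q_n` has summable coefficients by telescoping,
and `V` by Kaluza's theorem, the `a_k²` being log-convex.

Identification of the weight. `Q_0(z²)` is the mean over `t` of `((1 - z e^{it})(1 - z
e^{-it}))^{-1/2}`. On the unit circle this integrand has constant phase on each side of `t = θ`, and
the two phases differ by a right angle. The two pieces are pendulum integrals equal to `K(sin(θ/2))`
and `K(cos(θ/2))`, whence `π² |C_0|² = K² + K'²` (`norm_legendreC_zero_sq`). -/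

noncomputable section

/-- The solution of `S_{n+2} = x S_{n+1} + b_{n+1} S_n`, `S_0 = 1`, `S_1 = x`. -/
def symmetrization {R : Type*} [Field R] (b : ℕ → R) : ℕ → R[X]
  | 0 => 1
  | 1 => X
  | n + 2 => X * symmetrization b (n + 1) + C (b (n + 1)) * symmetrization b n

/-! ### Reciprocal invariance and the passage from `P_n(z)` to `S_n(x)`. -/

section Symmetrization

variable {R : Type*} [Field R]

theorem symmetrization_monic_natDegree (b : ℕ → R) (n : ℕ) :
    (symmetrization b n).Monic ∧ (symmetrization b n).natDegree = n := by
  induction n using Nat.strong_induction_on with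
  | _ n ih =>
    match n with
    | 0 => simp [symmetrization]
    | 1 => simp [symmetrization, monic_X]
    | n + 2 =>
      obtain ⟨m1, d1⟩ := ih (n + 1) (by omega)
      obtain ⟨m0, d0⟩ := ih n (by omega)
      have hm : (X * symmetrization b (n + 1)).Monic := monic_X.mul m1
      have hd : (X * symmetrization b (n + 1)).natDegree = n + 2 := by
        rw [monic_X.natDegree_mul m1, d1, natDegree_X]; omega
      have hlt : (C (b (n + 1)) * symmetrization b n).degree
          < (X * symmetrization b (n + 1)).degree := by
        rw [degree_eq_natDegree hm.ne_zero, hd]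
        refine lt_of_le_of_lt degree_le_natDegree ?_
        have h := natDegree_C_mul_le (b (n + 1)) (symmetrization b n)
        rw [d0] at h
        exact_mod_cast (by omega : (C (b (n + 1)) * symmetrization b n).natDegree < n + 2)
      refine ⟨hm.add_of_left hlt, ?_⟩
      rw [symmetrization, natDegree_add_eq_left_of_degree_lt hlt, hd]

theorem isSymmetricRecurrence_symmetrization (b : ℕ → R) :
    IsSymmetricRecurrence (fun n => -b n) (symmetrization b) where
  init := rfl
  rec_zero := by simp [symmetrization]
  rec_succ n := by simp [symmetrization]

theorem eq_assocLegendre_of_recurrence {S : ℕ → ℝ[X]} {ν : ℝ} {u : ℕ → ℝ}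
    (hu : ∀ n : ℕ, u (n + 1) = ((n + 1 : ℕ) + ν) ^ 2 / (((n + 1 : ℕ) + ν) ^ 2 - 1 / 4))
    (hS : IsSymmetricRecurrence u S) : S = assocLegendre ν := by
  funext n
  induction n using Nat.strong_induction_on with
  | _ n ih =>
    match n with
    | 0 => rw [hS.init, assocLegendre]
    | 1 => rw [hS.rec_zero, hS.init, assocLegendre, mul_one]
    | n + 2 =>
      rw [assocLegendre, ← ih (n + 1) (by omega), ← ih n (by omega), ← hu n, ← hS.rec_succ n]
      ring

theorem IsSymmetricRecurrence.eval_neg {u : ℕ → R} {S : ℕ → R[X]}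
    (hS : IsSymmetricRecurrence u S) (n : ℕ) (x : R) :
    (S n).eval (-x) = (-1) ^ n * (S n).eval x := by
  induction n using Nat.strong_induction_on with
  | _ n ih =>
    match n with
    | 0 => simp [hS.init]
    | 1 => simp [hS.rec_zero, hS.init]
    | n + 2 =>
      have h : S (n + 2) = X * S (n + 1) - C (u (n + 1)) * S n := by
        rw [← hS.rec_succ n]; ring
      rw [h]
      simp only [eval_sub, eval_mul, eval_X, eval_C]
      rw [ih (n + 1) (by omega), ih n (by omega)]
      ring

theorem IsLBP.eval_zero_succ {b d : ℕ → R} {P : ℕ → R[X]} (h : IsLBP d b P) (n : ℕ) :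
    (P (n + 1)).eval 0 = -d n * (P n).eval 0 := by
  cases n with
  | zero =>
    have := congrArg (eval 0) h.rec_zero
    simp at this
    linear_combination this
  | succ n =>
    have := congrArg (eval 0) (h.rec_succ n)
    simp at this
    linear_combination this

variable [Algebra R ℂ]

theorem IsLBP.isSymmetrization {b d : ℕ → R} {P : ℕ → R[X]} (h : IsLBP d b P)
    (hd : ∀ n, d n = -1) : IsSymmetrization P (symmetrization b) := by
  intro n z s hz hs
  have hs0 : s ≠ 0 := by rintro rfl; simp at hs; exact hz hs.symm
  subst hs
  induction n using Nat.strong_induction_on with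
  | _ n ih =>
    match n with
    | 0 => simp [symmetrization, h.init]
    | 1 =>
      have h1 : P 1 = X + 1 := by
        have := h.rec_zero
        rw [hd, h.init] at this
        simp only [C_neg, C_1, mul_one] at this
        linear_combination this
      simp [symmetrization, h1]
      field_simp
    | n + 2 =>
      have h2 : P (n + 2) = X * (P (n + 1) + C (b (n + 1)) * P n) + P (n + 1) := by
        have := h.rec_succ n
        rw [hd] at this
        simp only [C_neg, C_1] at this
        linear_combination this
      rw [symmetrization, h2]
      simp only [map_add, map_mul, aeval_X, aeval_C]
      rw [ih (n + 1) (by omega), ih n (by omega)]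
      have hst : s * s⁻¹ = 1 := mul_inv_cancel₀ hs0
      generalize s⁻¹ = t at *
      -- With `t` in place of `s⁻¹`, the identity is polynomial modulo `s * t = 1`.
      linear_combination (-(t ^ (n + 1) * s * aeval (s ^ 2) (P (n + 1))) -
        algebraMap R ℂ (b (n + 1)) * t ^ n * aeval (s ^ 2) (P n) * (1 + s * t)) * hst

/-- Both roots of `s² - x s + 1` have product `1`. Surjectivity of `s + s⁻¹` is what makes the
symmetrization unique. -/
theorem exists_add_inv_eq (x : ℂ) : ∃ s : ℂ, s ≠ 0 ∧ s + s⁻¹ = x := by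
  obtain ⟨r, hr⟩ := IsAlgClosed.exists_pow_nat_eq (x ^ 2 - 4) (n := 2) (by norm_num)
  have h : (x + r) / 2 * ((x - r) / 2) = 1 := by linear_combination -hr / 4
  refine ⟨(x + r) / 2, left_ne_zero_of_mul_eq_one h, ?_⟩
  rw [inv_eq_of_mul_eq_one_right h]
  ring

theorem IsSymmetrization.unique {P S T : ℕ → R[X]} (hT : IsSymmetrization P T)
    (hS : IsSymmetrization P S) : T = S := by
  funext n
  apply Polynomial.map_injective (algebraMap R ℂ) (algebraMap R ℂ).injective
  apply Polynomial.funext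
  intro x
  obtain ⟨s, hs, rfl⟩ := exists_add_inv_eq x
  simp only [eval_map_algebraMap]
  rw [hT n (s ^ 2) s (pow_ne_zero 2 hs) rfl, hS n (s ^ 2) s (pow_ne_zero 2 hs) rfl]

/-- The square roots `s` of `z` and `s⁻¹` of `1/z` give the same `x`, so both values of `P n` are
read off from one value of `S n`. -/
theorem IsSymmetrization.isReciprocalInvariant {P S : ℕ → R[X]} (hS : IsSymmetrization P S) :
    IsReciprocalInvariant P := by
  intro n z hz
  obtain ⟨s, rfl⟩ := IsAlgClosed.exists_pow_nat_eq z (n := 2) (by norm_num)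
  have hs : s ≠ 0 := by rintro rfl; simp at hz
  have h1 := hS n (s ^ 2) s hz rfl
  have h2 := hS n (1 / s ^ 2) s⁻¹ (by simpa using hs) (by simp)
  rw [inv_inv, add_comm, h1] at h2
  rw [← pow_mul, mul_comm 2 n, pow_mul, pow_two, mul_assoc, ← h2, ← mul_assoc, ← mul_pow,
    mul_inv_cancel₀ hs, one_pow, one_mul]

/-- Subtracting the reflected recurrence from the original leaves `(1 + d_n)(z - 1) P_n(z) = 0`.
Inductively `P_n(0) = 1`, so `P_n ≠ 0` and `d_n = -1`, which in turn gives `P_{n+1}(0) = 1`. -/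
theorem IsLBP.coeff_eq_neg_one {b d : ℕ → R} {P : ℕ → R[X]} (h : IsLBP d b P)
    (hP : IsReciprocalInvariant P) (n : ℕ) : d n = -1 := by
  have key : ∀ n, (∀ z : ℂ, z ≠ 0 →
      (1 + algebraMap R ℂ (d n)) * ((z - 1) * aeval z (P n)) = 0) := by
    intro n z hz
    cases n with
    | zero =>
      have h1 : P 1 = X - C (d 0) := by
        have := h.rec_zero
        rw [h.init] at this
        linear_combination this
      have := hP 1 z hz
      rw [h1] at this
      simp at this
      field_simp at this
      simp only [h.init, map_one, mul_one]
      linear_combination -this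
    | succ n =>
      have h2 : P (n + 2) = X * (P (n + 1) + C (b (n + 1)) * P n) - C (d (n + 1)) * P (n + 1) := by
        have := h.rec_succ n
        linear_combination this
      have e2 := hP (n + 2) z hz
      have e1 := hP (n + 1) z hz
      have e0 := hP n z hz
      rw [h2] at e2
      simp only [map_add, map_mul, aeval_X, aeval_C, map_sub] at e2
      rw [← e1, ← e0] at e2
      rw [← e1]
      have hz' : z * (1 / z) = 1 := by field_simp
      generalize aeval (1 / z) (P (n + 1)) = p1 at *
      generalize aeval (1 / z) (P n) = p0 at *
      generalize 1 / z = y at *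
      linear_combination -e2 +
        z ^ (n + 1) * (p1 + algebraMap R ℂ (b (n + 1)) * p0) * hz'
  have key2 : ∀ n, (P n).eval 0 = 1 → d n = -1 := by
    intro n hn
    by_contra hne
    have h1 : (1 + algebraMap R ℂ (d n)) ≠ 0 := by
      intro h0
      apply hne
      apply (algebraMap R ℂ).injective
      rw [map_neg, map_one]
      linear_combination h0
    have hp : P n ≠ 0 := by intro h0; simp [h0] at hn
    -- The factor `X` makes the product vanish at `0` too, where `key` says nothing.
    have hq : ((P n).map (algebraMap R ℂ)) * (X * (X - C 1)) ≠ 0 := by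
      refine mul_ne_zero ?_ (mul_ne_zero X_ne_zero (X_sub_C_ne_zero 1))
      rwa [Ne, Polynomial.map_eq_zero]
    apply hq
    apply Polynomial.funext
    intro z
    by_cases hz : z = 0
    · simp [hz]
    · have := (mul_eq_zero.1 (key n z hz)).resolve_left h1
      simp only [eval_mul, eval_map_algebraMap, eval_X, eval_sub, eval_C, eval_zero]
      linear_combination z * this
  have key3 : ∀ n, (P n).eval 0 = 1 := by
    intro n
    induction n with
    | zero => simp [h.init]
    | succ n ih => rw [h.eval_zero_succ, ih, key2 n ih]; simp
  exact key2 n (key3 n)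

end Symmetrization

/-! ### The Christoffel transform at `1`. -/

section Christoffel

theorem X_sub_one_mul_christoffelOne (P : ℕ → ℝ[X]) (n : ℕ) (h : (P n).eval 1 ≠ 0) :
    (X - C 1) * christoffelOne P n =
      P (n + 1) - C ((P (n + 1)).eval 1 / (P n).eval 1) * P n := by
  refine mul_divByMonic_eq_iff_isRoot.2 ?_
  simp only [IsRoot.def, eval_sub, eval_mul, eval_C]
  field_simp
  ring

theorem aeval_christoffelOne (P : ℕ → ℝ[X]) (n : ℕ) (h : (P n).eval 1 ≠ 0) (z : ℂ) :
    (z - 1) * aeval z (christoffelOne P n) =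
      aeval z (P (n + 1)) - (((P (n + 1)).eval 1 / (P n).eval 1 : ℝ) : ℂ) * aeval z (P n) := by
  have := congrArg (aeval z) (X_sub_one_mul_christoffelOne P n h)
  simp only [map_mul, map_sub, aeval_X, aeval_C, map_one] at this
  exact this

theorem eval_zero_christoffelOne (P : ℕ → ℝ[X]) (n : ℕ) (h : (P n).eval 1 ≠ 0)
    (h0 : (P n).eval 0 = 1) (h1 : (P (n + 1)).eval 0 = 1) :
    (christoffelOne P n).eval 0 = (P (n + 1)).eval 1 / (P n).eval 1 - 1 := by
  have := congrArg (eval 0) (X_sub_one_mul_christoffelOne P n h)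
  simp only [eval_mul, eval_sub, eval_X, eval_C, h0, h1] at this
  linear_combination -this

/-- Multiplied by `z - 1`, the second term becomes `-z^{n+1}(P_{n+1} - U_n P_n)(1/z) = -P_{n+1}(z) +
U_n z P_n(z)`, so `P_{n+1}` cancels and `U_n (z - 1) P_n` remains. The value `z = 1` follows by
continuity. -/
theorem christoffelOne_add_reciprocal (P : ℕ → ℝ[X]) (hP : IsReciprocalInvariant P) (n : ℕ)
    (h : (P n).eval 1 ≠ 0) (z : ℂ) (hz : z ≠ 0) :
    aeval z (christoffelOne P n) + z ^ n * aeval (1 / z) (christoffelOne P n) =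
      (((P (n + 1)).eval 1 / (P n).eval 1 : ℝ) : ℂ) * aeval z (P n) := by
  have main : ∀ z : ℂ, z ≠ 0 → z ≠ 1 →
      aeval z (christoffelOne P n) + z ^ n * aeval (1 / z) (christoffelOne P n) =
      (((P (n + 1)).eval 1 / (P n).eval 1 : ℝ) : ℂ) * aeval z (P n) := by
    intro z hz hz1
    have e1 := aeval_christoffelOne P n h z
    have e2 := aeval_christoffelOne P n h (1 / z)
    have r1 := hP (n + 1) z hz
    have r0 := hP n z hz
    have hz' : z * (1 / z) = 1 := by field_simp
    apply mul_left_cancel₀ (sub_ne_zero.2 hz1)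
    generalize (((P (n + 1)).eval 1 / (P n).eval 1 : ℝ) : ℂ) = U at *
    generalize 1 / z = y at *
    linear_combination e1 - z ^ (n + 1) * e2 - r1 + U * z * r0 +
      z ^ n * aeval y (christoffelOne P n) * hz'
  by_cases hz1 : z = 1
  · have hc : ∀ (p : ℝ[X]) (w : ℂ), ContinuousAt (fun z : ℂ => aeval z p) w := fun p w =>
      p.continuous_aeval.continuousAt
    have hi : ContinuousAt (fun z : ℂ => 1 / z) z := by
      simpa using continuousAt_inv₀ hz
    have hl : ContinuousAt (fun z : ℂ =>
        aeval z (christoffelOne P n) + z ^ n * aeval (1 / z) (christoffelOne P n)) z :=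
      (hc _ _).add ((continuousAt_id.pow n).mul
        (ContinuousAt.comp (f := fun z : ℂ => 1 / z) (hc (christoffelOne P n) (1 / z)) hi))
    have hr : ContinuousAt (fun z : ℂ =>
        (((P (n + 1)).eval 1 / (P n).eval 1 : ℝ) : ℂ) * aeval z (P n)) z :=
      continuousAt_const.mul (hc _ _)
    refine tendsto_nhds_unique_of_eventuallyEq (l := nhdsWithin z {z}ᶜ)
      (hl.mono_left nhdsWithin_le_nhds) (hr.mono_left nhdsWithin_le_nhds) ?_
    filter_upwards [self_mem_nhdsWithin, nhdsWithin_le_nhds (isOpen_ne.mem_nhds hz)] with y hy hy0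
    exact main y hy0 (by rw [← hz1]; exact hy)
  · exact main z hz hz1

end Christoffel

/-! ### Hermite's polynomials and their normalisation. -/

section Hermite

theorem ascPochhammer_eval_three_halves_pos (n : ℕ) : 0 < (ascPochhammer ℝ n).eval (3 / 2) :=
  ascPochhammer_pos n _ (by norm_num)

theorem hermiteXi_pos (n : ℕ) : 0 < hermiteXi n :=
  div_pos (by exact_mod_cast n.factorial_pos) (ascPochhammer_eval_three_halves_pos n)

theorem hermiteXi_zero : hermiteXi 0 = 1 := by simp [hermiteXi]

theorem hermiteXi_succ (n : ℕ) : (2 * (n : ℝ) + 3) * hermiteXi (n + 1) = 2 * (n + 1) * hermiteXi n := by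
  have h := ascPochhammer_eval_three_halves_pos n
  rw [hermiteXi, hermiteXi, ascPochhammer_succ_eval, Nat.factorial_succ]
  push_cast
  have h3 : (3 / 2 + (n : ℝ)) ≠ 0 := by positivity
  field_simp
  ring

/-- This ratio converts the coefficient `(2n+3)/(2n+5)` of the recurrence for `A_n` into `-b_{n+1}`
in the monic one. -/
theorem hermiteXi_eq (n : ℕ) : (2 * (n : ℝ) + 3) * hermiteXi n =
    (2 * (n : ℝ) + 5) * hermiteXi (n + 2) *
      ((((n + 1 : ℕ) : ℝ) + 1 / 2) ^ 2 / (((n + 1 : ℕ) : ℝ) * (((n + 1 : ℕ) : ℝ) + 1))) := by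
  have h1 := hermiteXi_succ n
  have h2 := hermiteXi_succ (n + 1)
  push_cast at h2 ⊢
  have h5 : (2 * (n : ℝ) + 5) ≠ 0 := by positivity
  have e1 : hermiteXi (n + 1) = (2 * (n : ℝ) + 5) / (2 * (n + 2)) * hermiteXi (n + 2) := by
    field_simp
    linear_combination -h2
  have e2 : hermiteXi n = (2 * (n : ℝ) + 3) / (2 * (n + 1)) * hermiteXi (n + 1) := by
    field_simp
    linear_combination -h1
  rw [e2, e1]
  have : (n : ℝ) + 1 + 1 ≠ 0 := by positivity
  field_simp
  ring

theorem hermiteA_succ_succ (n : ℕ) : C (2 * (n : ℝ) + 5) * hermiteA (n + 2) =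
    C (2 * ((n : ℝ) + 2)) * (1 + X) * hermiteA (n + 1) - C (2 * (n : ℝ) + 3) * X * hermiteA n := by
  rw [hermiteA, ← mul_assoc, ← C_mul, mul_one_div_cancel (by positivity), C_1, one_mul]

theorem hermiteP_zero : hermiteP 0 = 1 := by simp [hermiteP, hermiteXi_zero, hermiteA]

theorem hermiteP_one : hermiteP 1 = X + 1 := by
  have h : hermiteXi 1 = 2 / 3 := by
    have := hermiteXi_succ 0
    rw [hermiteXi_zero] at this
    norm_num at this
    linarith
  rw [hermiteP, hermiteA, h, ← mul_assoc, ← C_mul]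
  norm_num
  ring

theorem C_hermiteXi_mul_hermiteP (n : ℕ) : C (hermiteXi n) * hermiteP n = hermiteA n := by
  rw [hermiteP, ← mul_assoc, ← C_mul, mul_one_div_cancel (hermiteXi_pos n).ne', C_1, one_mul]

theorem isLBP_hermiteP :
    IsLBP (fun _ => (-1 : ℝ)) (fun n => -(((n : ℝ) + 1 / 2) ^ 2 / ((n : ℝ) * ((n : ℝ) + 1))))
      hermiteP where
  nondegenerate n hn := by
    have : (0 : ℝ) < n := by exact_mod_cast hn
    have : (0 : ℝ) < ((n : ℝ) + 1 / 2) ^ 2 / ((n : ℝ) * ((n : ℝ) + 1)) := by positivity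
    simp only [mul_neg, mul_one, neg_neg]
    exact this.ne'
  init := hermiteP_zero
  rec_zero := by rw [hermiteP_zero, hermiteP_one]; simp
  rec_succ n := by
    have h := hermiteA_succ_succ n
    simp only [← C_hermiteXi_mul_hermiteP] at h
    have h2 := hermiteXi_succ (n + 1)
    have h0 := (hermiteXi_pos (n + 2)).ne'
    have e0 := hermiteXi_eq n
    push_cast at h2 e0 ⊢
    have h5 : (2 * (n : ℝ) + 5) ≠ 0 := by positivity
    have hc : C (2 * (n : ℝ) + 3) * C (hermiteXi n) = C (2 * (n : ℝ) + 5) * C (hermiteXi (n + 2)) *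
          C (((n : ℝ) + 1 + 1 / 2) ^ 2 / (((n : ℝ) + 1) * ((n : ℝ) + 1 + 1))) := by
      rw [← C_mul, e0, C_mul, C_mul]
    have hc1 : C (2 * ((n : ℝ) + 2)) * C (hermiteXi (n + 1)) =
        C (2 * (n : ℝ) + 5) * C (hermiteXi (n + 2)) := by
      rw [← C_mul, ← C_mul]
      congr 1
      linear_combination -h2
    have hne : C ((2 * (n : ℝ) + 5) * hermiteXi (n + 2)) ≠ 0 := by
      rw [Ne, C_eq_zero]
      exact mul_ne_zero h5 h0
    apply mul_left_cancel₀ hne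
    simp only [C_neg, C_1, C_mul (a := 2 * (n : ℝ) + 5)]
    linear_combination h + (1 + X) * hermiteP (n + 1) * hc1 - X * hermiteP n * hc

/-- At `z = 1` the recurrence reads `(2n+5)(A_{n+2} - A_{n+1}) = (2n+3)(A_{n+1} - A_n)`, so the
increments keep their sign and `A_n(1) ≥ 1`. -/
theorem eval_one_hermiteA (n : ℕ) :
    (hermiteA 0).eval 1 ≤ (hermiteA n).eval 1 ∧ (hermiteA n).eval 1 ≤ (hermiteA (n + 1)).eval 1 := by
  induction n with
  | zero => norm_num [hermiteA]
  | succ n ih =>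
    refine ⟨ih.1.trans ih.2, ?_⟩
    have h := congrArg (eval 1) (hermiteA_succ_succ n)
    simp only [eval_mul, eval_C, eval_sub, eval_add, eval_one, eval_X] at h
    have h5 : (0 : ℝ) < 2 * n + 5 := by positivity
    have h3 : (0 : ℝ) < 2 * n + 3 := by positivity
    have := mul_nonneg h3.le (sub_nonneg.2 ih.2)
    rw [← sub_nonneg]
    refine nonneg_of_mul_nonneg_right ?_ h5
    linarith

theorem eval_one_hermiteP_ne_zero (n : ℕ) : (hermiteP n).eval 1 ≠ 0 := by
  have h := (eval_one_hermiteA n).1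
  simp only [hermiteA, eval_one] at h
  rw [hermiteP, eval_mul, eval_C]
  exact mul_ne_zero (one_div_pos.2 (hermiteXi_pos n)).ne' (by linarith)

end Hermite

/-! ### Evaluation of power series on the closed unit disc -/

/-- The sum of a real power series at a complex point. -/
def psEval (f : PowerSeries ℝ) (w : ℂ) : ℂ := ∑' k, ((PowerSeries.coeff k f : ℝ) : ℂ) * w ^ k

/-- Absolute convergence of a power series at a point. -/
def PSSummable (f : PowerSeries ℝ) (w : ℂ) : Prop :=
  Summable fun k => ‖((PowerSeries.coeff k f : ℝ) : ℂ) * w ^ k‖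

/-- Absolute summability of the coefficients. -/
def AbsSummable (f : PowerSeries ℝ) : Prop := Summable fun k => |PowerSeries.coeff k f|

theorem norm_coeff_mul_pow_le (f : PowerSeries ℝ) {w : ℂ} (hw : ‖w‖ ≤ 1) (k : ℕ) :
    ‖((PowerSeries.coeff k f : ℝ) : ℂ) * w ^ k‖ ≤ |PowerSeries.coeff k f| := by
  rw [norm_mul, norm_pow, Complex.norm_real, Real.norm_eq_abs]
  exact mul_le_of_le_one_right (abs_nonneg _) (pow_le_one₀ (norm_nonneg _) hw)

theorem AbsSummable.psSummable {f : PowerSeries ℝ} (hf : AbsSummable f) {w : ℂ} (hw : ‖w‖ ≤ 1) :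
    PSSummable f w :=
  Summable.of_nonneg_of_le (fun _ => norm_nonneg _) (norm_coeff_mul_pow_le f hw) hf

theorem psSummable_of_bounded {f : PowerSeries ℝ} {B : ℝ} (hf : ∀ k, |PowerSeries.coeff k f| ≤ B)
    {w : ℂ} (hw : ‖w‖ < 1) : PSSummable f w := by
  refine Summable.of_nonneg_of_le (fun _ => norm_nonneg _) (fun k => ?_)
    ((summable_geometric_of_lt_one (norm_nonneg w) hw).mul_left B)
  rw [norm_mul, norm_pow, Complex.norm_real, Real.norm_eq_abs]
  exact mul_le_mul_of_nonneg_right (hf k) (by positivity)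

theorem psEval_mul {f g : PowerSeries ℝ} {w : ℂ} (hf : PSSummable f w) (hg : PSSummable g w) :
    psEval (f * g) w = psEval f w * psEval g w := by
  rw [psEval, psEval, psEval, tsum_mul_tsum_eq_tsum_sum_antidiagonal_of_summable_norm hf hg]
  congr 1
  funext k
  rw [PowerSeries.coeff_mul, Complex.ofReal_sum, Finset.sum_mul]
  refine Finset.sum_congr rfl fun p hp => ?_
  rw [← Finset.HasAntidiagonal.mem_antidiagonal.1 hp, pow_add]
  push_cast
  ring

theorem psEval_add {f g : PowerSeries ℝ} {w : ℂ} (hf : PSSummable f w) (hg : PSSummable g w) :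
    psEval (f + g) w = psEval f w + psEval g w := by
  rw [psEval, psEval, psEval, ← Summable.tsum_add hf.of_norm hg.of_norm]
  congr 1
  funext k
  rw [map_add]
  push_cast
  ring

theorem hasSum_psEval_polynomial (p : ℝ[X]) (w : ℂ) :
    PSSummable (p : PowerSeries ℝ) w ∧ psEval (p : PowerSeries ℝ) w = aeval w p := by
  have h0 : ∀ k ∉ Finset.range (p.natDegree + 1),
      ((PowerSeries.coeff k (p : PowerSeries ℝ) : ℝ) : ℂ) * w ^ k = 0 := by
    intro k hk
    rw [Polynomial.coeff_coe, coeff_eq_zero_of_natDegree_lt]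
    · simp
    · simpa using hk
  refine ⟨summable_of_ne_finset_zero (s := Finset.range (p.natDegree + 1)) fun k hk => ?_, ?_⟩
  · rw [h0 k hk, norm_zero]
  · rw [psEval, tsum_eq_sum h0, aeval_eq_sum_range]
    refine Finset.sum_congr rfl fun k _ => ?_
    rw [Polynomial.coeff_coe, Complex.real_smul]

theorem psEval_polynomial_mul (p : ℝ[X]) {f : PowerSeries ℝ} {w : ℂ} (hf : PSSummable f w) :
    psEval (p * f) w = aeval w p * psEval f w := by
  rw [psEval_mul (hasSum_psEval_polynomial p w).1 hf, (hasSum_psEval_polynomial p w).2]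

/-- Continuity up to the circle is what lets identities and Cauchy's theorem reach the boundary. -/
theorem AbsSummable.continuousOn {f : PowerSeries ℝ} (hf : AbsSummable f) :
    ContinuousOn (psEval f) (Metric.closedBall 0 1) := by
  refine continuousOn_tsum (fun k => by fun_prop) hf fun k w hw => ?_
  exact norm_coeff_mul_pow_le f (by simpa using hw) k

theorem AbsSummable.differentiableOn {f : PowerSeries ℝ} (hf : AbsSummable f) :
    DifferentiableOn ℂ (psEval f) (Metric.ball 0 1) := by
  refine Complex.differentiableOn_tsum_of_summable_norm hf (fun k => by fun_prop) Metric.isOpen_ball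
    fun k w hw => ?_
  exact norm_coeff_mul_pow_le f (by simpa using (Metric.ball_subset_closedBall hw)) k

theorem psEval_conj (f : PowerSeries ℝ) (w : ℂ) :
    psEval f (starRingEnd ℂ w) = starRingEnd ℂ (psEval f w) := by
  rw [psEval, psEval, Complex.conj_tsum]
  simp

theorem coeff_one_sub_X_mul_succ (f : PowerSeries ℝ) (k : ℕ) :
    PowerSeries.coeff (k + 1) ((1 - PowerSeries.X) * f) =
      PowerSeries.coeff (k + 1) f - PowerSeries.coeff k f := by
  rw [sub_mul, one_mul, map_sub, PowerSeries.coeff_succ_X_mul]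

theorem coeff_one_sub_X_mul_zero (f : PowerSeries ℝ) :
    PowerSeries.coeff 0 ((1 - PowerSeries.X) * f) = PowerSeries.coeff 0 f := by
  simp

theorem summable_sub_succ_of_antitone {p : ℕ → ℝ} (h0 : ∀ k, 0 ≤ p k) (hp : Antitone p) :
    Summable fun k => p k - p (k + 1) := by
  refine summable_of_sum_range_le (c := p 0) (fun k => sub_nonneg.2 (hp k.le_succ)) fun n => ?_
  rw [Finset.sum_range_sub']
  linarith [h0 n]

/-- The coefficients become differences of a monotone sequence and telescope, even where those of
`p` are not summable. -/
theorem absSummable_one_sub_X_mul {p : ℕ → ℝ} (h0 : ∀ k, 0 ≤ p k) (hp : Antitone p) :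
    AbsSummable ((1 - PowerSeries.X) * PowerSeries.mk p) := by
  rw [AbsSummable, ← summable_nat_add_iff 1]
  refine (summable_sub_succ_of_antitone h0 hp).congr fun k => ?_
  rw [coeff_one_sub_X_mul_succ, PowerSeries.coeff_mk, PowerSeries.coeff_mk, abs_sub_comm,
    abs_of_nonneg (sub_nonneg.2 (hp k.le_succ))]

/-! ### Reciprocals of log-convex power series -/

theorem sum_antidiagonal_eq_sum_range_coeff (V : PowerSeries ℝ) (p : ℕ → ℝ) (n : ℕ) :
    PowerSeries.coeff n (V * PowerSeries.mk p) =
      ∑ k ∈ Finset.range (n + 1), PowerSeries.coeff k V * p (n - k) := by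
  rw [PowerSeries.coeff_mul, Finset.Nat.sum_antidiagonal_eq_sum_range_succ_mk]
  simp

/-- Kaluza's sign theorem. -/
theorem coeff_nonpos_of_logConvex {p : ℕ → ℝ} (hpos : ∀ k, 0 < p k)
    (hr : ∀ k m, k ≤ m → p (k + 1) * p m ≤ p (m + 1) * p k) (hp0 : p 0 = 1)
    {V : PowerSeries ℝ} (hV : V * PowerSeries.mk p = 1) (n : ℕ) :
    PowerSeries.coeff (n + 1) V ≤ 0 := by
  have hc : ∀ n, ∑ k ∈ Finset.range (n + 1), PowerSeries.coeff k V * p (n - k) =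
      if n = 0 then 1 else 0 := fun n => by
    rw [← sum_antidiagonal_eq_sum_range_coeff, hV, PowerSeries.coeff_one]
  induction n using Nat.strong_induction_on with
  | _ n ih =>
    have h1 := hc (n + 1)
    rw [Finset.sum_range_succ, Nat.sub_self, hp0, mul_one, if_neg (by omega)] at h1
    rcases Nat.eq_zero_or_pos n with rfl | hn
    · have h0 := hc 0
      simp [hp0] at h0 h1
      rw [h0] at h1
      have := hpos 1
      simp only [zero_add]
      linarith
    · have h2 := hc n
      rw [if_neg hn.ne'] at h2
      -- `p_n` times the identity at `n + 1` minus `p_{n+1}` times the one at `n`: the `k = 0` term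
      -- cancels, and for `k ≥ 1` both factors are nonpositive.
      have h3 : 0 ≤ ∑ k ∈ Finset.range (n + 1),
          PowerSeries.coeff k V * (p (n + 1 - k) * p n - p (n + 1) * p (n - k)) := by
        refine Finset.sum_nonneg fun k hk => ?_
        have hk' : k ≤ n := by simpa [Nat.lt_succ_iff] using hk
        rcases Nat.eq_zero_or_pos k with rfl | hk0
        · simp
        · obtain ⟨j, rfl⟩ : ∃ j, k = j + 1 := ⟨k - 1, by omega⟩
          refine mul_nonneg_of_nonpos_of_nonpos (ih j (by omega)) ?_
          have := hr (n - (j + 1)) n (Nat.sub_le _ _)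
          rw [show n + 1 - (j + 1) = n - (j + 1) + 1 by omega]
          linarith
      have h4 : ∑ k ∈ Finset.range (n + 1),
          PowerSeries.coeff k V * (p (n + 1 - k) * p n - p (n + 1) * p (n - k)) =
          p n * ∑ k ∈ Finset.range (n + 1), PowerSeries.coeff k V * p (n + 1 - k) -
          p (n + 1) * ∑ k ∈ Finset.range (n + 1), PowerSeries.coeff k V * p (n - k) := by
        rw [Finset.mul_sum, Finset.mul_sum, ← Finset.sum_sub_distrib]
        exact Finset.sum_congr rfl fun k _ => by ring
      rw [h4, h2, mul_zero, sub_zero] at h3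
      have := nonneg_of_mul_nonneg_right h3 (hpos n)
      linarith

/-- From `V * p = 1` and Kaluza, `∑_{1≤k≤n} |v_k| p_{n-k} = p_n`. Since `p_{n-k} ≥ p_n`, dividing by
`p_n` bounds every partial sum of the `|v_k|` by `1`. -/
theorem absSummable_inv_of_logConvex {p : ℕ → ℝ} (hpos : ∀ k, 0 < p k) (hanti : Antitone p)
    (hr : ∀ k m, k ≤ m → p (k + 1) * p m ≤ p (m + 1) * p k) (hp0 : p 0 = 1)
    {V : PowerSeries ℝ} (hV : V * PowerSeries.mk p = 1) : AbsSummable V := by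
  have hle := coeff_nonpos_of_logConvex hpos hr hp0 hV
  rw [AbsSummable, ← summable_nat_add_iff 1]
  refine summable_of_sum_range_le (c := 1) (fun _ => abs_nonneg _) fun n => ?_
  rcases Nat.eq_zero_or_pos n with rfl | hn
  · simp
  have h1 : ∑ k ∈ Finset.range (n + 1), PowerSeries.coeff k V * p (n - k) = 0 := by
    rw [← sum_antidiagonal_eq_sum_range_coeff, hV, PowerSeries.coeff_one, if_neg hn.ne']
  have h0 : PowerSeries.coeff 0 V = 1 := by
    have := sum_antidiagonal_eq_sum_range_coeff V p 0
    rw [hV] at this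
    simpa [hp0] using this.symm
  rw [Finset.sum_range_succ', h0, one_mul, Nat.sub_zero] at h1
  refine le_of_mul_le_mul_right ?_ (hpos n)
  rw [one_mul, Finset.sum_mul]
  refine le_of_le_of_eq ?_ (eq_neg_of_add_eq_zero_right h1).symm
  rw [← Finset.sum_neg_distrib]
  refine Finset.sum_le_sum fun k _ => ?_
  rw [abs_of_nonpos (hle k), ← neg_mul]
  exact mul_le_mul_of_nonneg_left (hanti (Nat.sub_le _ _)) (neg_nonneg.2 (hle k))

/-! ### The coefficients of `(1 - x)^{-1/2}` -/

/-- The coefficients `(1/2)_k / k!` of `(1 - x)^{-1/2}`. -/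
def invSqrtCoeff (k : ℕ) : ℝ := k.centralBinom / 4 ^ k

theorem invSqrtCoeff_zero : invSqrtCoeff 0 = 1 := by simp [invSqrtCoeff]

theorem invSqrtCoeff_pos (k : ℕ) : 0 < invSqrtCoeff k := by
  have : (0 : ℝ) < k.centralBinom := by exact_mod_cast k.centralBinom_pos
  rw [invSqrtCoeff]
  positivity

theorem invSqrtCoeff_succ (k : ℕ) :
    2 * ((k : ℝ) + 1) * invSqrtCoeff (k + 1) = (2 * k + 1) * invSqrtCoeff k := by
  have h : ((k : ℝ) + 1) * (k + 1).centralBinom = 2 * (2 * k + 1) * k.centralBinom := by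
    exact_mod_cast k.succ_mul_centralBinom_succ
  rw [invSqrtCoeff, invSqrtCoeff, pow_succ]
  field_simp
  linear_combination 2 * h

theorem invSqrtCoeff_succ' (k : ℕ) :
    invSqrtCoeff (k + 1) = (2 * k + 1) / (2 * (k + 1)) * invSqrtCoeff k := by
  have := invSqrtCoeff_succ k
  field_simp
  linear_combination this

theorem invSqrtCoeff_antitone : Antitone invSqrtCoeff := by
  refine antitone_nat_of_succ_le fun k => ?_
  have h := invSqrtCoeff_succ k
  have h1 := invSqrtCoeff_pos k
  have h2 : (0 : ℝ) < 2 * (k + 1) := by positivity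
  refine le_of_mul_le_mul_left ?_ h2
  rw [h]
  nlinarith

theorem invSqrtCoeff_le_one (k : ℕ) : invSqrtCoeff k ≤ 1 := by
  rw [← invSqrtCoeff_zero]
  exact invSqrtCoeff_antitone k.zero_le

/-- This exact link with Wallis' product is the source of the `π` in the Casoratian. -/
theorem invSqrtCoeff_sq_mul_wallis (k : ℕ) :
    invSqrtCoeff k ^ 2 * (2 * k + 1) * Real.Wallis.W k = 1 := by
  induction k with
  | zero => simp [invSqrtCoeff_zero, Real.Wallis.W]
  | succ k ih =>
    rw [Real.Wallis.W_succ, invSqrtCoeff_succ']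
    refine Eq.trans ?_ ih
    push_cast
    have : (2 * ((k : ℝ) + 1) + 1) ≠ 0 := by positivity
    have : (2 * (k : ℝ) + 3) ≠ 0 := by positivity
    have : (2 * (k : ℝ) + 1) ≠ 0 := by positivity
    field_simp
    ring

open Filter Topology in
theorem tendsto_invSqrtCoeff_sq :
    Tendsto (fun k : ℕ => invSqrtCoeff k ^ 2 * (2 * k + 1)) atTop (𝓝 (2 / Real.pi)) := by
  have h := Real.Wallis.tendsto_W_nhds_pi_div_two.inv₀ (by positivity)
  rw [inv_div] at h
  refine h.congr fun k => ?_
  exact inv_eq_of_mul_eq_one_left (invSqrtCoeff_sq_mul_wallis k)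

open Filter Topology in
theorem tendsto_invSqrtCoeff_ratio_one :
    Tendsto (fun n : ℕ => invSqrtCoeff (n + 1) / invSqrtCoeff n) atTop (𝓝 1) := by
  have h : Tendsto (fun n : ℕ => 1 - 1 / 2 * (1 / ((n : ℝ) + 1))) atTop (𝓝 (1 - 1 / 2 * 0)) :=
    (tendsto_one_div_add_atTop_nhds_zero_nat.const_mul _).const_sub _
  simp only [mul_zero, sub_zero] at h
  refine h.congr fun n => ?_
  rw [invSqrtCoeff_succ', mul_div_assoc, div_self (invSqrtCoeff_pos n).ne', mul_one]
  field_simp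
  ring

open Filter Topology in
theorem tendsto_invSqrtCoeff_ratio (k : ℕ) :
    Tendsto (fun n : ℕ => invSqrtCoeff (k + n) / invSqrtCoeff n) atTop (𝓝 1) := by
  induction k with
  | zero =>
    refine tendsto_const_nhds.congr fun n => ?_
    rw [zero_add, div_self (invSqrtCoeff_pos n).ne']
  | succ k ih =>
    have h := (tendsto_invSqrtCoeff_ratio_one.comp (tendsto_add_atTop_nat k)).mul ih
    rw [mul_one] at h
    refine h.congr fun n => ?_
    have h1 := (invSqrtCoeff_pos n).ne'
    have h2 := (invSqrtCoeff_pos (n + k)).ne'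
    simp only [Function.comp]
    rw [show k + 1 + n = n + k + 1 by omega, add_comm k n]
    field_simp

open Filter Topology in
theorem tendsto_invSqrtCoeff_mul_succ :
    Tendsto (fun n : ℕ => (2 * (n : ℝ) + 1) * (invSqrtCoeff n * invSqrtCoeff (n + 1))) atTop
      (𝓝 (2 / Real.pi)) := by
  have h := tendsto_invSqrtCoeff_sq.mul tendsto_invSqrtCoeff_ratio_one
  rw [mul_one] at h
  refine h.congr fun n => ?_
  have h1 := (invSqrtCoeff_pos n).ne'
  field_simp

/-! ### The associated power series -/

/-- The power series of `(1 - x)^{-1/2}`. -/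
def invSqrtSeries : PowerSeries ℝ := PowerSeries.mk invSqrtCoeff

/-- The power series of `(1 - x)^{1/2}`. -/
def sqrtSeries : PowerSeries ℝ := (1 - PowerSeries.X) * invSqrtSeries

/-- The coefficient recurrence is the equation `2(1 - x) f' = f`; it makes the derivative of the
product zero, and the constant term is `1`. -/
theorem one_sub_X_mul_invSqrtSeries_sq :
    (1 - PowerSeries.X) * invSqrtSeries * invSqrtSeries = 1 := by
  have hA : (2 : PowerSeries ℝ) * ((1 - PowerSeries.X) *
      PowerSeries.derivative ℝ invSqrtSeries) = invSqrtSeries := by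
    ext k
    rw [show (2 : PowerSeries ℝ) = PowerSeries.C (2 : ℝ) from (map_ofNat _ 2).symm, PowerSeries.coeff_C_mul]
    cases k with
    | zero =>
      rw [coeff_one_sub_X_mul_zero, PowerSeries.coeff_derivative, invSqrtSeries,
        PowerSeries.coeff_mk, PowerSeries.coeff_mk]
      have := invSqrtCoeff_succ 0
      push_cast at this ⊢
      linarith
    | succ k =>
      rw [coeff_one_sub_X_mul_succ, PowerSeries.coeff_derivative, PowerSeries.coeff_derivative,
        invSqrtSeries, PowerSeries.coeff_mk, PowerSeries.coeff_mk]
      have := invSqrtCoeff_succ (k + 1)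
      push_cast at this ⊢
      linarith
  apply PowerSeries.derivative.ext
  · simp only [Derivation.leibniz, map_sub, PowerSeries.derivative_X, Derivation.map_one_eq_zero,
      smul_eq_mul]
    linear_combination invSqrtSeries * hA
  · simp [invSqrtSeries, invSqrtCoeff_zero]

theorem sqrtSeries_mul_self : sqrtSeries * sqrtSeries = 1 - PowerSeries.X := by
  have := one_sub_X_mul_invSqrtSeries_sq
  rw [sqrtSeries]
  linear_combination (1 - PowerSeries.X) * this

theorem sqrtSeries_mul_invSqrtSeries : sqrtSeries * invSqrtSeries = 1 :=
  one_sub_X_mul_invSqrtSeries_sq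

theorem absSummable_sqrtSeries : AbsSummable sqrtSeries :=
  absSummable_one_sub_X_mul (fun k => (invSqrtCoeff_pos k).le) invSqrtCoeff_antitone

/-- The power series `∑ a_k a_{k+n} w^k`, with `a_k` the coefficients of `(1 - x)^{-1/2}`. Up to
elementary factors this is the Legendre function `Q_{n-1/2}`. -/
def legendreQSeries (n : ℕ) : PowerSeries ℝ :=
  PowerSeries.mk fun k => invSqrtCoeff k * invSqrtCoeff (k + n)

/-- `(1 - w) ∑ a_k a_{k+n} w^k`. -/
def legendreGSeries (n : ℕ) : PowerSeries ℝ := (1 - PowerSeries.X) * legendreQSeries n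

theorem legendreQ_coeff_nonneg (n k : ℕ) : 0 ≤ invSqrtCoeff k * invSqrtCoeff (k + n) :=
  (mul_pos (invSqrtCoeff_pos _) (invSqrtCoeff_pos _)).le

theorem legendreQ_coeff_antitone (n : ℕ) :
    Antitone fun k => invSqrtCoeff k * invSqrtCoeff (k + n) := fun k l h =>
  mul_le_mul (invSqrtCoeff_antitone h) (invSqrtCoeff_antitone (by omega))
    (invSqrtCoeff_pos _).le (invSqrtCoeff_pos _).le

theorem absSummable_legendreGSeries (n : ℕ) : AbsSummable (legendreGSeries n) :=
  absSummable_one_sub_X_mul (legendreQ_coeff_nonneg n) (legendreQ_coeff_antitone n)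

theorem legendreQSeries_rec (n : ℕ) :
    PowerSeries.C (2 * (n : ℝ) + 3) * (PowerSeries.X * legendreQSeries (n + 2)) +
      PowerSeries.C (2 * (n : ℝ) + 1) * legendreQSeries n =
      PowerSeries.C (2 * ((n : ℝ) + 1)) * ((1 + PowerSeries.X) * legendreQSeries (n + 1)) := by
  ext k
  simp only [map_add, PowerSeries.coeff_C_mul, add_mul, one_mul]
  cases k with
  | zero =>
    simp only [PowerSeries.coeff_zero_X_mul, legendreQSeries, PowerSeries.coeff_mk,
      invSqrtCoeff_zero, zero_add]
    linear_combination -invSqrtCoeff_succ n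
  | succ k =>
    simp only [PowerSeries.coeff_succ_X_mul, legendreQSeries, PowerSeries.coeff_mk]
    rw [show k + (n + 2) = k + n + 1 + 1 by ring, show k + 1 + n = k + n + 1 by ring,
      show k + 1 + (n + 1) = k + n + 1 + 1 by ring, show k + (n + 1) = k + n + 1 by ring,
      invSqrtCoeff_succ' (k + n + 1), invSqrtCoeff_succ' k]
    push_cast
    have : (k : ℝ) + n + 1 + 1 ≠ 0 := by positivity
    field_simp
    ring

theorem legendreGSeries_rec (n : ℕ) :
    PowerSeries.C (2 * (n : ℝ) + 3) * (PowerSeries.X * legendreGSeries (n + 2)) +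
      PowerSeries.C (2 * (n : ℝ) + 1) * legendreGSeries n =
      PowerSeries.C (2 * ((n : ℝ) + 1)) * ((1 + PowerSeries.X) * legendreGSeries (n + 1)) := by
  simp only [legendreGSeries]
  linear_combination (1 - PowerSeries.X) * legendreQSeries_rec n

/-- The reciprocal of `∑ a_k^2 w^k`. -/
def legendreVSeries : PowerSeries ℝ := (legendreQSeries 0)⁻¹

theorem legendreVSeries_mul : legendreVSeries * legendreQSeries 0 = 1 := by
  refine PowerSeries.inv_mul_cancel _ ?_
  simp [legendreQSeries, invSqrtCoeff_zero]

theorem legendreVSeries_mul_legendreGSeries :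
    legendreVSeries * legendreGSeries 0 = 1 - PowerSeries.X := by
  rw [legendreGSeries]
  linear_combination (1 - PowerSeries.X) * legendreVSeries_mul

theorem absSummable_legendreVSeries : AbsSummable legendreVSeries := by
  refine absSummable_inv_of_logConvex (p := fun k => invSqrtCoeff k * invSqrtCoeff (k + 0))
    (fun k => mul_pos (invSqrtCoeff_pos _) (invSqrtCoeff_pos _)) (legendreQ_coeff_antitone 0)
    (fun k m hkm => ?_) (by simp [invSqrtCoeff_zero]) legendreVSeries_mul
  simp only [add_zero]
  rw [invSqrtCoeff_succ', invSqrtCoeff_succ']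
  have hk := invSqrtCoeff_pos k
  have hm := invSqrtCoeff_pos m
  have hkm' : (k : ℝ) ≤ m := by exact_mod_cast hkm
  have h : (2 * (k : ℝ) + 1) / (2 * (k + 1)) ≤ (2 * m + 1) / (2 * (m + 1)) := by
    rw [div_le_div_iff₀ (by positivity) (by positivity)]
    nlinarith
  have h2 := mul_self_le_mul_self (by positivity) h
  have h3 := mul_le_mul_of_nonneg_right h2 (by positivity :
    0 ≤ (invSqrtCoeff k * invSqrtCoeff m) * (invSqrtCoeff k * invSqrtCoeff m))
  linarith

open Filter Topology in
-- Each `a_{k+n}/a_n` tends to `1`, so `(1 - w) Q_n / a_n` tends coefficientwise to `(1 - w)(1 -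
-- w)^{-1/2}`. Dominated convergence carries this to the closed disc.
theorem tendsto_legendreGSeries {w : ℂ} (hw : ‖w‖ ≤ 1) :
    Tendsto (fun n => psEval (legendreGSeries n) w / (invSqrtCoeff n : ℂ)) atTop
      (𝓝 (psEval sqrtSeries w)) := by
  have h0 : ∀ n k, PowerSeries.coeff (k + 1) (legendreGSeries n) =
      invSqrtCoeff (k + 1) * invSqrtCoeff (k + 1 + n) - invSqrtCoeff k * invSqrtCoeff (k + n) := by
    intro n k
    rw [legendreGSeries, coeff_one_sub_X_mul_succ, legendreQSeries, PowerSeries.coeff_mk,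
      PowerSeries.coeff_mk]
  have h1 : ∀ k, PowerSeries.coeff (k + 1) sqrtSeries =
      invSqrtCoeff (k + 1) - invSqrtCoeff k := by
    intro k
    rw [sqrtSeries, coeff_one_sub_X_mul_succ, invSqrtSeries, PowerSeries.coeff_mk,
      PowerSeries.coeff_mk]
  have h2 : ∀ n, PowerSeries.coeff 0 (legendreGSeries n) = invSqrtCoeff n := by
    intro n
    rw [legendreGSeries, coeff_one_sub_X_mul_zero, legendreQSeries, PowerSeries.coeff_mk,
      invSqrtCoeff_zero, one_mul, zero_add]
  have h3 : PowerSeries.coeff 0 sqrtSeries = 1 := by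
    rw [sqrtSeries, coeff_one_sub_X_mul_zero, invSqrtSeries, PowerSeries.coeff_mk,
      invSqrtCoeff_zero]
  have hlim : ∀ k, Tendsto (fun n => PowerSeries.coeff k (legendreGSeries n) / invSqrtCoeff n)
      atTop (𝓝 (PowerSeries.coeff k sqrtSeries)) := by
    intro k
    cases k with
    | zero =>
      rw [h3]
      refine tendsto_const_nhds.congr fun n => ?_
      rw [h2, div_self (invSqrtCoeff_pos n).ne']
    | succ k =>
      rw [h1]
      have := ((tendsto_invSqrtCoeff_ratio (k + 1)).const_mul (invSqrtCoeff (k + 1))).sub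
        ((tendsto_invSqrtCoeff_ratio k).const_mul (invSqrtCoeff k))
      rw [mul_one, mul_one] at this
      refine this.congr fun n => ?_
      rw [h0]
      ring
  have hbd : ∀ n k, |PowerSeries.coeff k (legendreGSeries n) / invSqrtCoeff n| ≤
      2 * |PowerSeries.coeff k sqrtSeries| := by
    intro n k
    have hn := invSqrtCoeff_pos n
    cases k with
    | zero =>
      rw [h2, h3, div_self hn.ne']
      norm_num
    | succ k =>
      have ha : invSqrtCoeff (k + 1) * invSqrtCoeff (k + 1 + n) ≤
          invSqrtCoeff k * invSqrtCoeff (k + n) := legendreQ_coeff_antitone n k.le_succ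
      have hb : invSqrtCoeff (k + 1) ≤ invSqrtCoeff k := invSqrtCoeff_antitone k.le_succ
      rw [h0, h1, abs_div, abs_of_pos hn, div_le_iff₀ hn, abs_sub_comm,
        abs_of_nonneg (sub_nonneg.2 ha), abs_sub_comm, abs_of_nonneg (sub_nonneg.2 hb)]
      have hk := invSqrtCoeff_pos k
      have hkn := invSqrtCoeff_pos (k + n)
      have hle : invSqrtCoeff (k + n) ≤ invSqrtCoeff n := invSqrtCoeff_antitone (by omega)
      rw [show k + 1 + n = k + n + 1 by ring, invSqrtCoeff_succ' k, invSqrtCoeff_succ' (k + n)]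
      push_cast
      have e1 : (2 * (k : ℝ) + 1) / (2 * (k + 1)) = 1 - 1 / (2 * (k + 1)) := by
        field_simp
        ring
      have e2 : (2 * ((k : ℝ) + n) + 1) / (2 * (k + n + 1)) = 1 - 1 / (2 * (k + n + 1)) := by
        field_simp
        ring
      rw [e1, e2]
      have hp : 0 < 1 / (2 * ((k : ℝ) + 1)) := by positivity
      have hq : 0 < 1 / (2 * ((k : ℝ) + n + 1)) := by positivity
      have hqp : 1 / (2 * ((k : ℝ) + n + 1)) ≤ 1 / (2 * ((k : ℝ) + 1)) := by
        apply one_div_le_one_div_of_le (by positivity)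
        have : (0 : ℝ) ≤ n := n.cast_nonneg
        linarith
      generalize 1 / (2 * ((k : ℝ) + 1)) = p at *
      generalize 1 / (2 * ((k : ℝ) + n + 1)) = q at *
      -- Here `1 - p` and `1 - q` are the ratios of consecutive `a`'s at `k` and `k + n`, and `a_k
      -- p` is the modulus of the coefficient `k + 1` of `sqrtSeries`. From `q ≤ p` comes the
      -- constant `2` in the bound.
      have i1 : invSqrtCoeff k * invSqrtCoeff (k + n) * (p + q - p * q) ≤
          invSqrtCoeff k * invSqrtCoeff (k + n) * (2 * p) := by
        refine mul_le_mul_of_nonneg_left ?_ (by positivity)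
        have := mul_pos hp hq
        linarith
      have i2 : invSqrtCoeff k * (2 * p) * invSqrtCoeff (k + n) ≤
          invSqrtCoeff k * (2 * p) * invSqrtCoeff n :=
        mul_le_mul_of_nonneg_left hle (by positivity)
      linarith
  have hdiv : ∀ n, psEval (legendreGSeries n) w / (invSqrtCoeff n : ℂ) =
      ∑' k, ((PowerSeries.coeff k (legendreGSeries n) / invSqrtCoeff n : ℝ) : ℂ) * w ^ k := by
    intro n
    rw [psEval, ← tsum_div_const]
    congr 1
    funext k
    push_cast
    ring
  simp only [hdiv]
  refine tendsto_tsum_of_dominated_convergence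
    (bound := fun k => 2 * |PowerSeries.coeff k sqrtSeries|)
    (absSummable_sqrtSeries.mul_left 2) (fun k => ?_) (Eventually.of_forall fun n k => ?_)
  · exact ((Complex.continuous_ofReal.tendsto _).comp (hlim k)).mul_const _
  · rw [norm_mul, norm_pow, Complex.norm_real, Real.norm_eq_abs]
    refine le_trans (mul_le_of_le_one_right (abs_nonneg _) (pow_le_one₀ (norm_nonneg _) hw)) ?_
    exact hbd n k

theorem psEval_one_sub_X (w : ℂ) : psEval (1 - PowerSeries.X) w = 1 - w := by
  have h := (hasSum_psEval_polynomial (1 - X) w).2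
  simpa using h

theorem psEval_sqrtSeries_sq {w : ℂ} (hw : ‖w‖ ≤ 1) : psEval sqrtSeries w ^ 2 = 1 - w := by
  rw [pow_two, ← psEval_mul (absSummable_sqrtSeries.psSummable hw)
    (absSummable_sqrtSeries.psSummable hw), sqrtSeries_mul_self, psEval_one_sub_X]

theorem norm_psEval_sqrtSeries_sq {w : ℂ} (hw : ‖w‖ ≤ 1) :
    ‖psEval sqrtSeries w‖ ^ 2 = ‖1 - w‖ := by
  rw [← norm_pow, psEval_sqrtSeries_sq hw]

theorem psEval_legendreVSeries_mul {w : ℂ} (hw : ‖w‖ ≤ 1) :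
    psEval legendreVSeries w * psEval (legendreGSeries 0) w = 1 - w := by
  rw [← psEval_mul (absSummable_legendreVSeries.psSummable hw)
    ((absSummable_legendreGSeries 0).psSummable hw), legendreVSeries_mul_legendreGSeries,
    psEval_one_sub_X]

theorem psEval_legendreGSeries_rec (n : ℕ) {w : ℂ} (hw : ‖w‖ ≤ 1) :
    (2 * (n : ℂ) + 3) * (w * psEval (legendreGSeries (n + 2)) w) +
      (2 * (n : ℂ) + 1) * psEval (legendreGSeries n) w =
      2 * ((n : ℂ) + 1) * ((1 + w) * psEval (legendreGSeries (n + 1)) w) := by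
  have hs : ∀ n, PSSummable (legendreGSeries n) w := fun n =>
    (absSummable_legendreGSeries n).psSummable hw
  have hc : ∀ (p : ℝ[X]) n, PSSummable ((p : PowerSeries ℝ) * legendreGSeries n) w := by
    intro p n
    have : AbsSummable ((p : PowerSeries ℝ) * legendreGSeries n) := by
      have hp : AbsSummable (p : PowerSeries ℝ) := by
        have := (hasSum_psEval_polynomial p 1).1
        simpa [PSSummable, AbsSummable] using this
      have := summable_norm_sum_mul_antidiagonal_of_summable_norm (f := fun k =>
        PowerSeries.coeff k (p : PowerSeries ℝ)) (g := fun k =>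
        PowerSeries.coeff k (legendreGSeries n)) hp (absSummable_legendreGSeries n)
      refine this.congr fun k => ?_
      rw [PowerSeries.coeff_mul, Real.norm_eq_abs]
    exact this.psSummable hw
  have h := congrArg (fun f => psEval f w) (legendreGSeries_rec n)
  have e1 : PowerSeries.C (2 * (n : ℝ) + 3) * (PowerSeries.X * legendreGSeries (n + 2)) =
      ((C (2 * (n : ℝ) + 3) * X : ℝ[X]) : PowerSeries ℝ) * legendreGSeries (n + 2) := by
    rw [Polynomial.coe_mul, Polynomial.coe_C, Polynomial.coe_X, mul_assoc]
  have e2 : PowerSeries.C (2 * (n : ℝ) + 1) * legendreGSeries n =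
      ((C (2 * (n : ℝ) + 1) : ℝ[X]) : PowerSeries ℝ) * legendreGSeries n := by
    rw [Polynomial.coe_C]
  have e3 : PowerSeries.C (2 * ((n : ℝ) + 1)) * ((1 + PowerSeries.X) * legendreGSeries (n + 1)) =
      ((C (2 * ((n : ℝ) + 1)) * (1 + X) : ℝ[X]) : PowerSeries ℝ) * legendreGSeries (n + 1) := by
    rw [Polynomial.coe_mul, Polynomial.coe_C, Polynomial.coe_add, Polynomial.coe_X,
      Polynomial.coe_one, mul_assoc]
  rw [e1, e2, e3, psEval_add (hc _ _) (hc _ _), psEval_polynomial_mul _ (hs _),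
    psEval_polynomial_mul _ (hs _), psEval_polynomial_mul _ (hs _)] at h
  simp only [map_add, map_mul, aeval_X, map_one, map_ofNat, map_natCast] at h
  linear_combination h

/-! ### Boundary values on the unit circle and their Casoratian. -/

/-- The boundary values `z^n ∑ a_k a_{k+n} z^{2k}` at `z = e^{iθ}`. -/
def legendreC (n : ℕ) (θ : ℝ) : ℂ :=
  Complex.exp (θ * Complex.I) ^ n *
    psEval (legendreGSeries n) (Complex.exp (θ * Complex.I) ^ 2) /
      (1 - Complex.exp (θ * Complex.I) ^ 2)

theorem norm_exp_sq (θ : ℝ) : ‖Complex.exp (θ * Complex.I) ^ 2‖ = 1 := by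
  rw [norm_pow, Complex.norm_exp_ofReal_mul_I, one_pow]

theorem one_sub_exp_sq (θ : ℝ) : 1 - Complex.exp (θ * Complex.I) ^ 2 =
    -2 * Complex.I * Complex.exp (θ * Complex.I) * (Real.sin θ : ℂ) := by
  have h1 := Complex.cos_sq_add_sin_sq (θ : ℂ)
  rw [Complex.exp_mul_I, Complex.ofReal_sin]
  linear_combination (-1 : ℂ) * h1 + Complex.sin θ ^ 2 * Complex.I_sq

theorem one_add_exp_sq (θ : ℝ) : 1 + Complex.exp (θ * Complex.I) ^ 2 =
    Complex.exp (θ * Complex.I) * (2 * Real.cos θ : ℝ) := by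
  have h1 := Complex.cos_sq_add_sin_sq (θ : ℂ)
  rw [Complex.exp_mul_I]
  push_cast
  linear_combination (-1 : ℂ) * h1 + (Complex.sin θ ^ 2) * Complex.I_sq

theorem norm_one_sub_exp_sq {θ : ℝ} (h : 0 < Real.sin θ) :
    ‖1 - Complex.exp (θ * Complex.I) ^ 2‖ = 2 * Real.sin θ := by
  rw [one_sub_exp_sq, norm_mul, norm_mul, norm_mul, Complex.norm_exp_ofReal_mul_I,
    Complex.norm_real, Real.norm_of_nonneg h.le]
  simp

theorem one_sub_exp_sq_ne_zero {θ : ℝ} (h : 0 < Real.sin θ) :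
    1 - Complex.exp (θ * Complex.I) ^ 2 ≠ 0 := by
  rw [← norm_ne_zero_iff, norm_one_sub_exp_sq h]
  positivity

theorem legendreC_rec (n : ℕ) (θ : ℝ) :
    (2 * (n : ℂ) + 3) * legendreC (n + 2) θ + (2 * (n : ℂ) + 1) * legendreC n θ =
      2 * ((n : ℂ) + 1) * (2 * Real.cos θ : ℝ) * legendreC (n + 1) θ := by
  have h := psEval_legendreGSeries_rec n (norm_exp_sq θ).le
  have h2 := one_add_exp_sq θ
  simp only [legendreC, div_eq_mul_inv]
  generalize (1 - Complex.exp (θ * Complex.I) ^ 2)⁻¹ = D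
  generalize Complex.exp (θ * Complex.I) = z at *
  linear_combination z ^ n * D * h +
    2 * ((n : ℂ) + 1) * z ^ n * D * psEval (legendreGSeries (n + 1)) (z ^ 2) * h2

/-- Multiplying the recurrence by `conj C_{n+1}` and taking imaginary parts removes the middle term,
its coefficient being real. -/
theorem im_legendreC_mul_conj (n : ℕ) (θ : ℝ) :
    (2 * (n : ℝ) + 1) * (legendreC (n + 1) θ * starRingEnd ℂ (legendreC n θ)).im =
      (legendreC 1 θ * starRingEnd ℂ (legendreC 0 θ)).im := by
  induction n with
  | zero => simp
  | succ n ih =>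
    have h := legendreC_rec n θ
    rw [← ih]
    have h1 := congrArg Complex.re h
    have h2 := congrArg Complex.im h
    simp only [Complex.add_re, Complex.mul_re, Complex.add_im, Complex.mul_im, Complex.natCast_re,
      Complex.natCast_im, Complex.re_ofNat, Complex.im_ofNat, Complex.one_re, Complex.one_im,
      Complex.ofReal_re, Complex.ofReal_im, Complex.conj_re, Complex.conj_im] at h1 h2 ⊢
    push_cast
    linear_combination (legendreC (n + 1) θ).re * h2 - (legendreC (n + 1) θ).im * h1

open Filter Topology in
-- The invariant Casoratian is evaluated as `n → ∞`, where `C_n ≈ a_n z^n H/(1 - z²)` with `|H|² =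
-- |1 - z²| = 2 sin θ`. The limit is `(2/π) · sin θ/(2 sin θ)`.
theorem im_legendreC_one_mul_conj {θ : ℝ} (hθ : 0 < Real.sin θ) :
    (legendreC 1 θ * starRingEnd ℂ (legendreC 0 θ)).im = 1 / Real.pi := by
  set z := Complex.exp (θ * Complex.I) with hz
  set H := psEval sqrtSeries (z ^ 2) with hH
  set g : ℕ → ℂ := fun n => psEval (legendreGSeries n) (z ^ 2) / (invSqrtCoeff n : ℂ) with hg
  have hg1 : Tendsto g atTop (𝓝 H) := tendsto_legendreGSeries (norm_exp_sq θ).le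
  have hzz : z * starRingEnd ℂ z = 1 := by
    rw [Complex.mul_conj, Complex.normSq_eq_norm_sq, hz, Complex.norm_exp_ofReal_mul_I]
    simp
  have hlim : Tendsto (fun n : ℕ => (2 * (n : ℝ) + 1) * (invSqrtCoeff n * invSqrtCoeff (n + 1)) *
      ((z * g (n + 1) * starRingEnd ℂ (g n)).im / ‖1 - z ^ 2‖ ^ 2)) atTop
      (𝓝 (2 / Real.pi * ((z * H * starRingEnd ℂ H).im / ‖1 - z ^ 2‖ ^ 2))) := by
    refine tendsto_invSqrtCoeff_mul_succ.mul (Tendsto.div_const ?_ _)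
    refine (Complex.continuous_im.tendsto _).comp ?_
    refine ((hg1.comp (tendsto_add_atTop_nat 1)).const_mul z).mul ?_
    exact (Complex.continuous_conj.tendsto _).comp hg1
  have hconst : ∀ n : ℕ, (2 * (n : ℝ) + 1) * (invSqrtCoeff n * invSqrtCoeff (n + 1)) *
      ((z * g (n + 1) * starRingEnd ℂ (g n)).im / ‖1 - z ^ 2‖ ^ 2) =
      (legendreC 1 θ * starRingEnd ℂ (legendreC 0 θ)).im := by
    intro n
    rw [← im_legendreC_mul_conj n θ]
    have hC : ∀ n, legendreC n θ = z ^ n * (invSqrtCoeff n * g n) / (1 - z ^ 2) := by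
      intro n
      have : (invSqrtCoeff n : ℂ) ≠ 0 := by exact_mod_cast (invSqrtCoeff_pos n).ne'
      rw [legendreC, hg]
      simp only
      rw [mul_div_cancel₀ _ this]
    have : legendreC (n + 1) θ * starRingEnd ℂ (legendreC n θ) =
        ((invSqrtCoeff n * invSqrtCoeff (n + 1) / ‖1 - z ^ 2‖ ^ 2 : ℝ) : ℂ) *
          (z * g (n + 1) * starRingEnd ℂ (g n)) := by
      rw [hC, hC, map_div₀, map_mul, map_mul, map_pow, Complex.conj_ofReal, div_mul_div_comm,
        Complex.mul_conj, Complex.normSq_eq_norm_sq]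
      push_cast
      have e : z ^ n * starRingEnd ℂ z ^ n = 1 := by rw [← mul_pow, hzz, one_pow]
      rw [div_mul_eq_mul_div]
      congr 1
      linear_combination (z * (invSqrtCoeff (n + 1) : ℂ) * g (n + 1) * (invSqrtCoeff n : ℂ) *
        starRingEnd ℂ (g n)) * e
    rw [this, Complex.im_ofReal_mul]
    ring
  simp only [hconst] at hlim
  rw [tendsto_nhds_unique tendsto_const_nhds hlim]
  have h1 : z * H * starRingEnd ℂ H = ((2 * Real.sin θ : ℝ) : ℂ) * z := by
    rw [mul_assoc, Complex.mul_conj, Complex.normSq_eq_norm_sq, hH,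
      norm_psEval_sqrtSeries_sq (norm_exp_sq θ).le, norm_one_sub_exp_sq hθ, mul_comm]
  have h2 : z.im = Real.sin θ := Complex.exp_ofReal_mul_I_im θ
  rw [h1, Complex.im_ofReal_mul, h2, norm_one_sub_exp_sq hθ]
  field_simp

theorem legendreV_mul_legendreC_zero {θ : ℝ} (hθ : 0 < Real.sin θ) :
    psEval legendreVSeries (Complex.exp (θ * Complex.I) ^ 2) * legendreC 0 θ = 1 := by
  rw [legendreC, pow_zero, one_mul, ← mul_div_assoc,
    psEval_legendreVSeries_mul (norm_exp_sq θ).le, div_self (one_sub_exp_sq_ne_zero hθ)]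

/-- `C_{n+1}` and `ξ_n S_n(2 cos θ)` obey the same recurrence. Only the reality of `r` matters
afterwards: with `V C_0 = 1`, the second term has no imaginary part after multiplication by `V`. -/
theorem legendreC_succ_eq {S : ℕ → ℝ[X]}
    (hS : IsSymmetricRecurrence
      (fun n => ((n : ℝ) + 1 / 2) ^ 2 / ((n : ℝ) * ((n : ℝ) + 1))) S) (n : ℕ) (θ : ℝ) :
    ∃ r : ℝ, legendreC (n + 1) θ =
      (hermiteXi n * (S n).eval (2 * Real.cos θ) : ℝ) * legendreC 1 θ + r * legendreC 0 θ := by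
  induction n using Nat.strong_induction_on with
  | _ n ih =>
    match n with
    | 0 => exact ⟨0, by simp [hermiteXi_zero, hS.init]⟩
    | 1 =>
      -- From `3 C_2 + C_0 = 2 (2 cos θ) C_1`.
      refine ⟨-1 / 3, ?_⟩
      have h := legendreC_rec 0 θ
      have hx := hermiteXi_succ 0
      rw [hermiteXi_zero] at hx
      have hx' : hermiteXi 1 = 2 / 3 := by norm_num at hx; linarith
      rw [hS.rec_zero, hS.init, hx', mul_one, eval_X]
      push_cast at h ⊢
      simp only [zero_add] at h
      linear_combination h / 3
    | n + 2 =>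
      obtain ⟨r1, h1⟩ := ih (n + 1) (by omega)
      obtain ⟨r0, h0⟩ := ih n (by omega)
      have h := legendreC_rec (n + 1) θ
      rw [h1, h0] at h
      have x1 := hermiteXi_succ (n + 1)
      have x0 := hermiteXi_eq n
      have hs := congrArg (eval (2 * Real.cos θ)) (hS.rec_succ n)
      simp only [eval_add, eval_mul, eval_C, eval_X] at hs
      have h5 : (2 * (n : ℝ) + 5) ≠ 0 := by positivity
      have h5' : (2 * (n : ℂ) + 5) ≠ 0 := by exact_mod_cast h5
      refine ⟨(2 * ((n : ℝ) + 2) * (2 * Real.cos θ) * r1 - (2 * (n : ℝ) + 3) * r0) /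
        (2 * (n : ℝ) + 5), ?_⟩
      have key : (2 * (n : ℝ) + 5) * (hermiteXi (n + 2) * (S (n + 2)).eval (2 * Real.cos θ)) =
          2 * ((n : ℝ) + 2) * (2 * Real.cos θ) *
            (hermiteXi (n + 1) * (S (n + 1)).eval (2 * Real.cos θ)) -
          (2 * (n : ℝ) + 3) * (hermiteXi n * (S n).eval (2 * Real.cos θ)) := by
        push_cast at x1 x0 hs
        linear_combination (2 * (n : ℝ) + 5) * hermiteXi (n + 2) * hs +
          (S n).eval (2 * Real.cos θ) * x0 +
          2 * Real.cos θ * (S (n + 1)).eval (2 * Real.cos θ) * x1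
      have key' := congrArg (fun t : ℝ => (t : ℂ)) key
      push_cast at key' h ⊢
      apply mul_left_cancel₀ h5'
      have e : (2 * (n : ℂ) + 5) * ((2 * ((n : ℂ) + 2) * (2 * Complex.cos θ) * r1 -
          (2 * (n : ℂ) + 3) * r0) / (2 * (n : ℂ) + 5)) =
          2 * ((n : ℂ) + 2) * (2 * Complex.cos θ) * r1 - (2 * (n : ℂ) + 3) * r0 :=
        mul_div_cancel₀ _ h5'
      linear_combination h - legendreC 1 θ * key' - legendreC 0 θ * e

/-- The polynomials `S_n` against the weight `|V|^2`, as the real part of a function that is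
holomorphic in the unit disc. -/
theorem re_legendre_boundary {S : ℕ → ℝ[X]}
    (hS : IsSymmetricRecurrence
      (fun n => ((n : ℝ) + 1 / 2) ^ 2 / ((n : ℝ) * ((n : ℝ) + 1))) S) (n : ℕ) {θ : ℝ}
    (hθ : 0 < Real.sin θ) :
    (Complex.exp (θ * Complex.I) ^ n *
      psEval (legendreGSeries (n + 1)) (Complex.exp (θ * Complex.I) ^ 2) *
      psEval legendreVSeries (Complex.exp (θ * Complex.I) ^ 2)).re =
    2 / Real.pi * hermiteXi n * ((S n).eval (2 * Real.cos θ) *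
      ‖psEval legendreVSeries (Complex.exp (θ * Complex.I) ^ 2)‖ ^ 2 * Real.sin θ) := by
  obtain ⟨r, hr⟩ := legendreC_succ_eq hS n θ
  have hV := legendreV_mul_legendreC_zero hθ
  have hW := im_legendreC_one_mul_conj hθ
  have h1 := one_sub_exp_sq θ
  have h2 := one_sub_exp_sq_ne_zero hθ
  set V := psEval legendreVSeries (Complex.exp (θ * Complex.I) ^ 2) with hVdef
  have e1 : Complex.exp (θ * Complex.I) ^ n *
      psEval (legendreGSeries (n + 1)) (Complex.exp (θ * Complex.I) ^ 2) * V =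
      -2 * Complex.I * (Real.sin θ : ℂ) * (legendreC (n + 1) θ * V) := by
    rw [legendreC, pow_succ _ n]
    have hz : Complex.exp (θ * Complex.I) ≠ 0 := Complex.exp_ne_zero _
    rw [div_mul_eq_mul_div, mul_div_assoc', eq_div_iff h2, h1]
    ring
  -- `V C_0 = 1` gives `V = |V|² conj C_0`, which brings in the Casoratian.
  have e2 : legendreC 1 θ * V = ((‖V‖ ^ 2 : ℝ) : ℂ) * (legendreC 1 θ * starRingEnd ℂ (legendreC 0 θ)) := by
    have : starRingEnd ℂ V * starRingEnd ℂ (legendreC 0 θ) = 1 := by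
      rw [← map_mul, hV, map_one]
    rw [← Complex.normSq_eq_norm_sq, ← Complex.mul_conj]
    linear_combination -(legendreC 1 θ * V) * this
  have e3 : (legendreC (n + 1) θ * V).im =
      hermiteXi n * (S n).eval (2 * Real.cos θ) * (‖V‖ ^ 2 * (1 / Real.pi)) := by
    have : legendreC (n + 1) θ * V = (hermiteXi n * (S n).eval (2 * Real.cos θ) : ℝ) *
        (legendreC 1 θ * V) + r := by
      rw [hr]
      linear_combination (r : ℂ) * hV
    rw [this, e2, Complex.add_im, Complex.ofReal_im, Complex.im_ofReal_mul, Complex.im_ofReal_mul,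
      hW, add_zero]
  have e4 : ∀ (s : ℝ) (q : ℂ), (-2 * Complex.I * (s : ℂ) * q).re = 2 * s * q.im := by
    intro s q
    simp
  rw [e1, e4, e3]
  ring

theorem continuous_psEval_exp_sq {f : PowerSeries ℝ} (hf : AbsSummable f) :
    Continuous fun θ : ℝ => psEval f (Complex.exp (θ * Complex.I) ^ 2) := by
  refine hf.continuousOn.comp_continuous (by fun_prop) fun θ => ?_
  rw [mem_closedBall_zero_iff, norm_exp_sq]

theorem integral_eq_add_self_of_reflect {E : Type*} [NormedAddCommGroup E] [NormedSpace ℝ E]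
    {f : ℝ → E} (hf : Continuous f) (hsym : ∀ t, f (2 * Real.pi - t) = f t) :
    ∫ t in (0 : ℝ)..2 * Real.pi, f t =
      (∫ t in (0 : ℝ)..Real.pi, f t) + ∫ t in (0 : ℝ)..Real.pi, f t := by
  have hsplit := intervalIntegral.integral_add_adjacent_intervals
    (hf.intervalIntegrable 0 Real.pi (μ := MeasureTheory.volume))
    (hf.intervalIntegrable Real.pi (2 * Real.pi) (μ := MeasureTheory.volume))
  have hrefl : ∫ t in (0 : ℝ)..Real.pi, f t = ∫ t in Real.pi..2 * Real.pi, f t := by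
    have := intervalIntegral.integral_comp_sub_left f (2 * Real.pi) (a := 0) (b := Real.pi)
    simp only [hsym] at this
    rw [this]
    congr 1 <;> ring
  rw [← hsplit, ← hrefl]

/-- Cauchy's theorem on the circle, halved to `[0, π]` by the symmetry under conjugation that real
coefficients give. -/
theorem integral_re_legendre_boundary (n : ℕ) (hn : 1 ≤ n) :
    ∫ θ in (0 : ℝ)..Real.pi, (Complex.exp (θ * Complex.I) ^ n *
      psEval (legendreGSeries (n + 1)) (Complex.exp (θ * Complex.I) ^ 2) *
      psEval legendreVSeries (Complex.exp (θ * Complex.I) ^ 2)).re = 0 := by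
  obtain ⟨m, rfl⟩ : ∃ m, n = m + 1 := ⟨n - 1, by omega⟩
  set s : ℝ → ℂ := fun θ => Complex.exp (θ * Complex.I) ^ (m + 1) *
      psEval (legendreGSeries (m + 1 + 1)) (Complex.exp (θ * Complex.I) ^ 2) *
      psEval legendreVSeries (Complex.exp (θ * Complex.I) ^ 2) with hs
  have hcont : Continuous s :=
    ((by fun_prop : Continuous fun θ : ℝ => Complex.exp (θ * Complex.I) ^ (m + 1)).mul
      (continuous_psEval_exp_sq (absSummable_legendreGSeries _))).mul
      (continuous_psEval_exp_sq absSummable_legendreVSeries)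
  have hmaps : Set.MapsTo (fun z : ℂ => z ^ 2) (Metric.closedBall 0 1) (Metric.closedBall 0 1) := by
    intro z hz
    rw [mem_closedBall_zero_iff] at hz ⊢
    rw [norm_pow]
    exact pow_le_one₀ (norm_nonneg _) hz
  have hmaps' : Set.MapsTo (fun z : ℂ => z ^ 2) (Metric.ball 0 1) (Metric.ball 0 1) := by
    intro z hz
    rw [mem_ball_zero_iff] at hz ⊢
    rw [norm_pow]
    exact pow_lt_one₀ (norm_nonneg _) hz (by norm_num)
  -- The exponent is `m = n - 1` because `dz = i z dθ` supplies one factor `z`; this is where `n ≥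
  -- 1` enters.
  have hC : (∮ z in C(0, 1), z ^ m * psEval (legendreGSeries (m + 1 + 1)) (z ^ 2) *
      psEval legendreVSeries (z ^ 2)) = 0 := by
    refine Complex.circleIntegral_eq_zero_of_differentiable_on_off_countable zero_le_one
      Set.countable_empty ?_ ?_
    · refine ((by fun_prop : ContinuousOn (fun z : ℂ => z ^ m) _).mul ?_).mul ?_
      · exact (absSummable_legendreGSeries _).continuousOn.comp (by fun_prop) hmaps
      · exact absSummable_legendreVSeries.continuousOn.comp (by fun_prop) hmaps
    · intro z hz
      have hz' : z ∈ Metric.ball (0 : ℂ) 1 := hz.1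
      refine DifferentiableOn.differentiableAt ?_ (Metric.isOpen_ball.mem_nhds hz')
      refine ((by fun_prop : DifferentiableOn ℂ (fun z : ℂ => z ^ m) _).mul ?_).mul ?_
      · exact (absSummable_legendreGSeries _).differentiableOn.comp (by fun_prop) hmaps'
      · exact absSummable_legendreVSeries.differentiableOn.comp (by fun_prop) hmaps'
  have h2π : ∫ θ in (0 : ℝ)..2 * Real.pi, s θ = 0 := by
    rw [circleIntegral_def_Icc, MeasureTheory.integral_Icc_eq_integral_Ioc,
      ← intervalIntegral.integral_of_le (by positivity)] at hC
    have : ∀ θ : ℝ, deriv (circleMap 0 1) θ • (circleMap 0 1 θ ^ m *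
        psEval (legendreGSeries (m + 1 + 1)) (circleMap 0 1 θ ^ 2) *
        psEval legendreVSeries (circleMap 0 1 θ ^ 2)) = Complex.I * s θ := by
      intro θ
      rw [deriv_circleMap, hs]
      simp only [circleMap, zero_add, Complex.ofReal_one, one_mul, smul_eq_mul]
      ring
    simp only [this] at hC
    rw [intervalIntegral.integral_const_mul] at hC
    exact (mul_eq_zero.1 hC).resolve_left Complex.I_ne_zero
  have hre : ∫ θ in (0 : ℝ)..2 * Real.pi, (s θ).re = 0 := by
    have := Complex.reCLM.intervalIntegral_comp_comm
      (hcont.intervalIntegrable 0 (2 * Real.pi) (μ := MeasureTheory.volume))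
    simp only [Complex.reCLM_apply] at this
    rw [this, h2π, Complex.zero_re]
  have hsym : ∀ θ : ℝ, (s (2 * Real.pi - θ)).re = (s θ).re := by
    intro θ
    have hz : Complex.exp ((2 * Real.pi - θ : ℝ) * Complex.I) =
        starRingEnd ℂ (Complex.exp (θ * Complex.I)) := by
      rw [← Complex.exp_conj, map_mul, Complex.conj_ofReal, Complex.conj_I]
      rw [show ((2 * Real.pi - θ : ℝ) : ℂ) * Complex.I =
        (θ : ℂ) * -Complex.I + 2 * Real.pi * Complex.I by push_cast; ring,
        Complex.exp_periodic]
    have : s (2 * Real.pi - θ) = starRingEnd ℂ (s θ) := by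
      rw [hs]
      simp only
      rw [hz]
      simp only [map_mul, map_pow, ← psEval_conj]
    rw [this, Complex.conj_re]
  have hi : Continuous fun θ => (s θ).re := Complex.continuous_re.comp hcont
  rw [integral_eq_add_self_of_reflect hi hsym] at hre
  linarith

/-! ### The integral representation of `Q_0(z²)` inside the disc. -/

theorem integral_exp_int_mul_I (m : ℤ) :
    ∫ t in (0 : ℝ)..2 * Real.pi, Complex.exp (m * Complex.I * t) =
      if m = 0 then 2 * (Real.pi : ℂ) else 0 := by
  split_ifs with h
  · simp [h]
  · have hc : (m : ℂ) * Complex.I ≠ 0 := mul_ne_zero (by exact_mod_cast h) Complex.I_ne_zero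
    rw [integral_exp_mul_complex hc]
    have : (m : ℂ) * Complex.I * ((2 * Real.pi : ℝ) : ℂ) = m * (2 * Real.pi * Complex.I) := by
      push_cast
      ring
    rw [this, Complex.exp_int_mul_two_pi_mul_I]
    simp

theorem psSummable_invSqrtSeries {w : ℂ} (hw : ‖w‖ < 1) : PSSummable invSqrtSeries w := by
  refine psSummable_of_bounded (B := 1) (fun k => ?_) hw
  rw [invSqrtSeries, PowerSeries.coeff_mk, abs_of_pos (invSqrtCoeff_pos k)]
  exact invSqrtCoeff_le_one k

theorem psSummable_legendreQSeries {w : ℂ} (hw : ‖w‖ < 1) : PSSummable (legendreQSeries 0) w := by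
  refine psSummable_of_bounded (B := 1) (fun k => ?_) hw
  rw [legendreQSeries, PowerSeries.coeff_mk, abs_of_nonneg (legendreQ_coeff_nonneg 0 k)]
  exact mul_le_one₀ (invSqrtCoeff_le_one _) (invSqrtCoeff_pos _).le (invSqrtCoeff_le_one _)

theorem norm_mul_exp (z : ℂ) (t : ℝ) : ‖z * Complex.exp (t * Complex.I)‖ = ‖z‖ := by
  rw [norm_mul, Complex.norm_exp_ofReal_mul_I, mul_one]

/-- In the double series only the diagonal terms `j = k` survive integration, leaving the
coefficients `a_k²`. -/
theorem integral_invSqrtSeries_mul {z : ℂ} (hz : ‖z‖ < 1) :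
    ∫ t in (0 : ℝ)..2 * Real.pi, psEval invSqrtSeries (z * Complex.exp (t * Complex.I)) *
      psEval invSqrtSeries (z * Complex.exp ((-t : ℝ) * Complex.I)) =
      2 * Real.pi * psEval (legendreQSeries 0) (z ^ 2) := by
  set F : ℕ × ℕ → ℝ → ℂ := fun p t =>
    ((PowerSeries.coeff p.1 invSqrtSeries : ℝ) : ℂ) * (z * Complex.exp (t * Complex.I)) ^ p.1 *
    (((PowerSeries.coeff p.2 invSqrtSeries : ℝ) : ℂ) *
      (z * Complex.exp ((-t : ℝ) * Complex.I)) ^ p.2) with hF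
  set B : ℕ → ℝ := fun k => ‖((PowerSeries.coeff k invSqrtSeries : ℝ) : ℂ) * z ^ k‖ with hB
  have hBs : Summable B := psSummable_invSqrtSeries hz
  have hBB : Summable fun p : ℕ × ℕ => B p.1 * B p.2 :=
    hBs.mul_of_nonneg hBs (fun _ => norm_nonneg _) (fun _ => norm_nonneg _)
  have key := intervalIntegral.hasSum_integral_of_dominated_convergence (F := F)
    (μ := MeasureTheory.volume) (a := 0) (b := 2 * Real.pi)
    (f := fun t => psEval invSqrtSeries (z * Complex.exp (t * Complex.I)) *
      psEval invSqrtSeries (z * Complex.exp ((-t : ℝ) * Complex.I)))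
    (fun p _ => B p.1 * B p.2)
    (fun p => (by fun_prop : Continuous (F p)).aestronglyMeasurable)
    (fun p => Filter.Eventually.of_forall fun t _ => by
      simp only [hF, hB, norm_mul, norm_pow, Complex.norm_exp_ofReal_mul_I, mul_one]
      exact le_rfl)
    (Filter.Eventually.of_forall fun t _ => hBB)
    (intervalIntegrable_const)
    (Filter.Eventually.of_forall fun t _ => by
      have s1 := psSummable_invSqrtSeries (w := z * Complex.exp (t * Complex.I))
        (by rwa [norm_mul_exp])
      have s2 := psSummable_invSqrtSeries (w := z * Complex.exp ((-t : ℝ) * Complex.I))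
        (by rwa [norm_mul_exp])
      rw [psEval, psEval, tsum_mul_tsum_of_summable_norm s1 s2]
      exact (summable_mul_of_summable_norm s1 s2).hasSum)
  have hint : ∀ p : ℕ × ℕ, ∫ t in (0 : ℝ)..2 * Real.pi, F p t =
      if p.1 = p.2 then 2 * Real.pi *
        ((PowerSeries.coeff p.1 (legendreQSeries 0) : ℝ) : ℂ) * (z ^ 2) ^ p.1 else 0 := by
    rintro ⟨j, k⟩
    have : ∀ t : ℝ, F (j, k) t = (invSqrtCoeff j * z ^ j * (invSqrtCoeff k * z ^ k)) *
        Complex.exp (((j : ℤ) - (k : ℤ) : ℤ) * Complex.I * t) := by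
      intro t
      simp only [hF, invSqrtSeries, PowerSeries.coeff_mk, mul_pow]
      rw [← Complex.exp_nat_mul, ← Complex.exp_nat_mul,
        show (((j : ℤ) - (k : ℤ) : ℤ) : ℂ) * Complex.I * t =
          (j : ℂ) * (t * Complex.I) + (k : ℂ) * ((-t : ℝ) * Complex.I) by push_cast; ring,
        Complex.exp_add]
      ring
    simp only [this]
    rw [intervalIntegral.integral_const_mul, integral_exp_int_mul_I]
    by_cases h : j = k
    · subst h
      simp [legendreQSeries]
      ring
    · rw [if_neg (by omega), if_neg h, mul_zero]
  simp only [hint] at key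
  have hinj : Function.Injective fun j : ℕ => (j, j) := fun a b h => (Prod.ext_iff.1 h).1
  rw [← hinj.hasSum_iff] at key
  · rw [← key.tsum_eq, psEval, ← tsum_mul_left]
    congr 1
    funext k
    simp [mul_assoc]
  · rintro ⟨j, k⟩ hp
    exact if_neg fun h => hp ⟨j, Prod.ext rfl h⟩

theorem continuous_psEval_comp {f : PowerSeries ℝ} (hf : AbsSummable f) {g : ℝ → ℂ}
    (hg : Continuous g) (h : ∀ t, ‖g t‖ ≤ 1) : Continuous fun t => psEval f (g t) :=
  hf.continuousOn.comp_continuous hg fun t => by simpa using h t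

theorem psEval_invSqrtSeries_eq {w : ℂ} (hw : ‖w‖ < 1) :
    psEval invSqrtSeries w = (psEval sqrtSeries w)⁻¹ := by
  refine eq_inv_of_mul_eq_one_right ?_
  rw [← psEval_mul (absSummable_sqrtSeries.psSummable hw.le) (psSummable_invSqrtSeries hw),
    sqrtSeries_mul_invSqrtSeries]
  simpa using (hasSum_psEval_polynomial 1 w).2

theorem psEval_sqrtSeries_ne_zero {w : ℂ} (hw : ‖w‖ ≤ 1) (h1 : w ≠ 1) :
    psEval sqrtSeries w ≠ 0 := by
  intro h
  have := psEval_sqrtSeries_sq hw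
  rw [h] at this
  apply h1
  linear_combination this

/-- The integrand of the Laplace-type integral for `∑ a_k^2 z^{2k}`, at `z = r e^{iθ}`. -/
def legendreKernel (r θ t : ℝ) : ℂ :=
  (psEval sqrtSeries (r * Complex.exp ((θ + t : ℝ) * Complex.I)) *
    psEval sqrtSeries (r * Complex.exp ((θ - t : ℝ) * Complex.I)))⁻¹

theorem norm_real_mul_exp {r : ℝ} (h0 : 0 ≤ r) (φ : ℝ) :
    ‖(r : ℂ) * Complex.exp (φ * Complex.I)‖ = r := by
  rw [norm_mul_exp, Complex.norm_real, Real.norm_of_nonneg h0]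

theorem integral_legendreKernel {r : ℝ} (h0 : 0 ≤ r) (h1 : r < 1) (θ : ℝ) :
    ∫ t in (0 : ℝ)..Real.pi, legendreKernel r θ t =
      Real.pi * (psEval (legendreGSeries 0) ((r * Complex.exp (θ * Complex.I)) ^ 2) /
        (1 - (r * Complex.exp (θ * Complex.I)) ^ 2)) := by
  set z : ℂ := r * Complex.exp (θ * Complex.I) with hz
  have hn : ∀ φ : ℝ, ‖(r : ℂ) * Complex.exp (φ * Complex.I)‖ < 1 := fun φ => by
    rwa [norm_real_mul_exp h0]
  have hz2 : ‖z ^ 2‖ < 1 := by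
    rw [norm_pow]
    exact pow_lt_one₀ (norm_nonneg _) (hn θ) (by norm_num)
  have hQ : psEval (legendreQSeries 0) (z ^ 2) = psEval (legendreGSeries 0) (z ^ 2) / (1 - z ^ 2) := by
    have hne : 1 - z ^ 2 ≠ 0 := by
      intro h
      rw [← sub_eq_zero.1 h] at hz2
      simp at hz2
    rw [eq_div_iff hne, legendreGSeries, mul_comm]
    have := psEval_polynomial_mul (1 - X) (psSummable_legendreQSeries hz2)
    simpa using this.symm
  have e : ∀ t : ℝ, psEval invSqrtSeries (z * Complex.exp (t * Complex.I)) *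
      psEval invSqrtSeries (z * Complex.exp ((-t : ℝ) * Complex.I)) = legendreKernel r θ t := by
    intro t
    have a1 : z * Complex.exp (t * Complex.I) = r * Complex.exp ((θ + t : ℝ) * Complex.I) := by
      rw [hz, mul_assoc, ← Complex.exp_add]
      push_cast
      ring_nf
    have a2 : z * Complex.exp ((-t : ℝ) * Complex.I) =
        r * Complex.exp ((θ - t : ℝ) * Complex.I) := by
      rw [hz, mul_assoc, ← Complex.exp_add]
      push_cast
      ring_nf
    rw [a1, a2, psEval_invSqrtSeries_eq (hn _), psEval_invSqrtSeries_eq (hn _), legendreKernel,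
      mul_inv]
  have hI := integral_invSqrtSeries_mul (hn θ)
  rw [← hz] at hI
  simp only [e] at hI
  have hcont : Continuous (legendreKernel r θ) := by
    refine Continuous.inv₀ ?_ fun t => ?_
    · exact (continuous_psEval_comp absSummable_sqrtSeries (by fun_prop) fun t => (hn _).le).mul
        (continuous_psEval_comp absSummable_sqrtSeries (by fun_prop) fun t => (hn _).le)
    · have : ∀ φ : ℝ, psEval sqrtSeries (r * Complex.exp (φ * Complex.I)) ≠ 0 := fun φ =>
        psEval_sqrtSeries_ne_zero (hn φ).le fun h => by have := hn φ; rw [h] at this; simp at this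
      exact mul_ne_zero (this _) (this _)
  have hsym : ∀ t, legendreKernel r θ (2 * Real.pi - t) = legendreKernel r θ t := by
    intro t
    have b1 : Complex.exp ((θ + (2 * Real.pi - t) : ℝ) * Complex.I) =
        Complex.exp ((θ - t : ℝ) * Complex.I) := by
      rw [show ((θ + (2 * Real.pi - t) : ℝ) : ℂ) * Complex.I =
        ((θ - t : ℝ) : ℂ) * Complex.I + 2 * Real.pi * Complex.I by push_cast; ring,
        Complex.exp_periodic]
    have b2 : Complex.exp ((θ - (2 * Real.pi - t) : ℝ) * Complex.I) =
        Complex.exp ((θ + t : ℝ) * Complex.I) := by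
      rw [show ((θ - (2 * Real.pi - t) : ℝ) : ℂ) * Complex.I =
        ((θ + t : ℝ) : ℂ) * Complex.I - 2 * Real.pi * Complex.I by push_cast; ring,
        Complex.exp_periodic.sub_eq]
    rw [legendreKernel, legendreKernel, b1, b2, mul_comm]
  rw [integral_eq_add_self_of_reflect hcont hsym, hQ] at hI
  linear_combination hI / 2

/-! ### The branch of the square root -/

/-- The constant term is `1` and the remaining coefficients have absolute sum at most `1`. This
fixes the sign of the square root, including on the circle. -/
theorem re_psEval_sqrtSeries_nonneg {w : ℂ} (hw : ‖w‖ ≤ 1) : 0 ≤ (psEval sqrtSeries w).re := by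
  have hs := absSummable_sqrtSeries.psSummable hw
  have h0 : PowerSeries.coeff 0 sqrtSeries = 1 := by
    rw [sqrtSeries, coeff_one_sub_X_mul_zero, invSqrtSeries, PowerSeries.coeff_mk,
      invSqrtCoeff_zero]
  have hk : ∀ k, |PowerSeries.coeff (k + 1) sqrtSeries| =
      invSqrtCoeff k - invSqrtCoeff (k + 1) := by
    intro k
    rw [sqrtSeries, coeff_one_sub_X_mul_succ, invSqrtSeries, PowerSeries.coeff_mk,
      PowerSeries.coeff_mk, abs_sub_comm,
      abs_of_nonneg (sub_nonneg.2 (invSqrtCoeff_antitone k.le_succ))]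
  rw [psEval, hs.of_norm.tsum_eq_zero_add, h0]
  have hs1 := (summable_nat_add_iff 1).2 hs
  have hsum : Summable fun k => invSqrtCoeff k - invSqrtCoeff (k + 1) :=
    summable_sub_succ_of_antitone (fun k => (invSqrtCoeff_pos k).le) invSqrtCoeff_antitone
  have hle : ‖∑' k, ((PowerSeries.coeff (k + 1) sqrtSeries : ℝ) : ℂ) * w ^ (k + 1)‖ ≤ 1 := by
    refine (norm_tsum_le_tsum_norm hs1).trans ?_
    refine (hs1.tsum_le_tsum (fun k => ?_) hsum).trans ?_
    · rw [← hk]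
      exact norm_coeff_mul_pow_le _ hw _
    · refine hsum.tsum_le_of_sum_range_le fun n => ?_
      rw [Finset.sum_range_sub', invSqrtCoeff_zero]
      linarith [invSqrtCoeff_pos n]
  have := (abs_le.1 ((Complex.abs_re_le_norm _).trans hle)).1
  rw [Complex.add_re]
  simp only [Complex.ofReal_one, pow_zero, mul_one, Complex.one_re]
  linarith

/-- Both sides square to `1 - e^{iφ} = 2 sin(φ/2) e^{i(φ-π)/2}`; the opposite sign would have
negative real part, since `|(φ - π)/4| < π/4`. -/
theorem psEval_sqrtSeries_exp {φ : ℝ} (h0 : 0 < φ) (h1 : φ < 2 * Real.pi) :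
    psEval sqrtSeries (Complex.exp (φ * Complex.I)) =
      (√(2 * Real.sin (φ / 2)) : ℝ) * Complex.exp (((φ - Real.pi) / 4 : ℝ) * Complex.I) := by
  have hw : ‖Complex.exp (φ * Complex.I)‖ ≤ 1 := (Complex.norm_exp_ofReal_mul_I φ).le
  have hs : 0 < Real.sin (φ / 2) := Real.sin_pos_of_pos_of_lt_pi (by linarith) (by linarith)
  have hsq : psEval sqrtSeries (Complex.exp (φ * Complex.I)) ^ 2 =
      ((√(2 * Real.sin (φ / 2)) : ℝ) * Complex.exp (((φ - Real.pi) / 4 : ℝ) * Complex.I)) ^ 2 := by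
    have h2 : Complex.exp (φ * Complex.I) = Complex.exp ((φ / 2 : ℝ) * Complex.I) ^ 2 := by
      rw [← Complex.exp_nat_mul]
      push_cast
      ring_nf
    have h3 : Complex.exp (((φ - Real.pi) / 4 : ℝ) * Complex.I) ^ 2 =
        Complex.exp ((φ / 2 : ℝ) * Complex.I) * -Complex.I := by
      rw [← Complex.exp_neg_pi_div_two_mul_I, ← Complex.exp_add, ← Complex.exp_nat_mul]
      push_cast
      ring_nf
    rw [psEval_sqrtSeries_sq hw, h2, one_sub_exp_sq, mul_pow, h3, ← Complex.ofReal_pow,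
      Real.sq_sqrt (by positivity)]
    push_cast
    ring
  refine (sq_eq_sq_iff_eq_or_eq_neg.1 hsq).resolve_right fun h => ?_
  have hre := re_psEval_sqrtSeries_nonneg hw
  rw [h, Complex.neg_re, Complex.re_ofReal_mul, Complex.exp_ofReal_mul_I_re] at hre
  have hc : 0 < Real.cos ((φ - Real.pi) / 4) :=
    Real.cos_pos_of_mem_Ioo ⟨by linarith [Real.pi_pos], by linarith [Real.pi_pos]⟩
  have := mul_pos (Real.sqrt_pos.2 (by positivity : 0 < 2 * Real.sin (φ / 2))) hc
  linarith

theorem four_mul_sin_mul_sin (θ t : ℝ) :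
    2 * Real.sin ((θ + t) / 2) * (2 * Real.sin ((θ - t) / 2)) =
      2 * Real.cos t - 2 * Real.cos θ := by
  have := Real.cos_sub_cos t θ
  rw [show (t - θ) / 2 = -((θ - t) / 2) by ring, Real.sin_neg, add_comm t θ] at this
  linear_combination -2 * this

/-- The phases `(θ ± t - π)/4` add up to `θ/2 - π/2`, independent of `t`. -/
theorem legendreKernel_one_of_lt {θ t : ℝ} (h0 : 0 < t) (h1 : t < θ) (h2 : θ < Real.pi) :
    legendreKernel 1 θ t = (1 / √(2 * Real.cos t - 2 * Real.cos θ) : ℝ) *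
      (Complex.exp ((-(θ / 2) : ℝ) * Complex.I) * Complex.I) := by
  have hs : 0 ≤ 2 * Real.sin ((θ + t) / 2) :=
    mul_nonneg zero_le_two (Real.sin_nonneg_of_nonneg_of_le_pi (by linarith) (by linarith))
  have he : Complex.exp (-(((θ + t - Real.pi) / 4 : ℝ) * Complex.I +
      ((θ - t - Real.pi) / 4 : ℝ) * Complex.I)) =
      Complex.exp ((-(θ / 2) : ℝ) * Complex.I) * Complex.I := by
    rw [show -((((θ + t - Real.pi) / 4 : ℝ) : ℂ) * Complex.I +
      ((θ - t - Real.pi) / 4 : ℝ) * Complex.I) =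
      (-(θ / 2) : ℝ) * Complex.I + Real.pi / 2 * Complex.I by push_cast; ring,
      Complex.exp_add, Complex.exp_pi_div_two_mul_I]
  rw [legendreKernel, Complex.ofReal_one, one_mul, one_mul,
    psEval_sqrtSeries_exp (by linarith) (by linarith),
    psEval_sqrtSeries_exp (by linarith) (by linarith), mul_mul_mul_comm, ← Complex.ofReal_mul,
    ← Real.sqrt_mul hs, four_mul_sin_mul_sin, ← Complex.exp_add, mul_inv, ← Complex.exp_neg,
    he, one_div, Complex.ofReal_inv]

/-- Now `θ - t < 0`, so the second root is the conjugate of the one at `t - θ` and the phases add up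
to `θ/2`: a quarter turn from the case `t < θ`. -/
theorem legendreKernel_one_of_gt {θ t : ℝ} (h0 : 0 < θ) (h1 : θ < t) (h2 : t < Real.pi) :
    legendreKernel 1 θ t = (1 / √(2 * Real.cos θ - 2 * Real.cos t) : ℝ) *
      Complex.exp ((-(θ / 2) : ℝ) * Complex.I) := by
  have hs : 0 ≤ 2 * Real.sin ((t + θ) / 2) :=
    mul_nonneg zero_le_two (Real.sin_nonneg_of_nonneg_of_le_pi (by linarith) (by linarith))
  have hconj : Complex.exp ((θ - t : ℝ) * Complex.I) =
      starRingEnd ℂ (Complex.exp ((t - θ : ℝ) * Complex.I)) := by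
    rw [← Complex.exp_conj, map_mul, Complex.conj_ofReal, Complex.conj_I]
    push_cast
    ring_nf
  rw [legendreKernel, Complex.ofReal_one, one_mul, one_mul, hconj, psEval_conj, add_comm θ t,
    psEval_sqrtSeries_exp (by linarith) (by linarith),
    psEval_sqrtSeries_exp (by linarith) (by linarith), map_mul, Complex.conj_ofReal,
    ← Complex.exp_conj, map_mul, Complex.conj_ofReal, Complex.conj_I, mul_mul_mul_comm,
    ← Complex.ofReal_mul,
    ← Real.sqrt_mul hs, four_mul_sin_mul_sin, ← Complex.exp_add, mul_inv, ← Complex.exp_neg]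
  push_cast
  rw [one_div]
  ring_nf

/-! ### The elliptic integral as a pendulum integral -/

theorem cos_half_sq (θ : ℝ) : Real.cos (θ / 2) ^ 2 = 1 / 2 + Real.cos θ / 2 := by
  rw [Real.cos_sq, mul_div_cancel₀ _ two_ne_zero]

/-- The substitution is `k s = sin(t/2)` with `k = sin(θ/2)`. -/
theorem ellipticK_sin {θ : ℝ} (h0 : 0 < θ) (hπ : θ < Real.pi) :
    ellipticK (Real.sin (θ / 2)) =
      ∫ t in (0 : ℝ)..θ, 1 / √(2 * Real.cos t - 2 * Real.cos θ) := by
  set k := Real.sin (θ / 2) with hk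
  have hk0 : 0 < k := Real.sin_pos_of_pos_of_lt_pi (by linarith) (by linarith)
  have hlt : ∀ t ∈ Set.Ioo 0 θ, 0 < Real.sin (t / 2) ∧ Real.sin (t / 2) < k ∧
      0 < Real.cos (t / 2) := by
    intro t ht
    refine ⟨Real.sin_pos_of_pos_of_lt_pi (by linarith [ht.1]) (by linarith [ht.2]),
      Real.sin_lt_sin_of_lt_of_le_pi_div_two (by linarith [ht.1]) (by linarith) (by linarith [ht.2]),
      Real.cos_pos_of_mem_Ioo ⟨by linarith [ht.1], by linarith [ht.2]⟩⟩
  have himage : (fun t => Real.sin (t / 2) / k) '' Set.Ioo 0 θ = Set.Ioo 0 1 := by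
    ext s
    constructor
    · rintro ⟨t, ht, rfl⟩
      obtain ⟨a, b, -⟩ := hlt t ht
      exact ⟨div_pos a hk0, (div_lt_one hk0).2 b⟩
    · rintro ⟨hs0, hs1⟩
      have hk1 : k ≤ 1 := Real.sin_le_one _
      have hks : 0 < k * s := mul_pos hk0 hs0
      have hks1 : k * s < k := mul_lt_of_lt_one_right hk0 hs1
      refine ⟨2 * Real.arcsin (k * s), ⟨?_, ?_⟩, ?_⟩
      · have := Real.arcsin_pos.2 hks
        linarith
      · have : Real.arcsin (k * s) < θ / 2 :=
          (Real.arcsin_lt_iff_lt_sin ⟨by linarith, by linarith⟩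
            ⟨by linarith, by linarith⟩).2 hks1
        linarith
      · simp only
        rw [mul_div_cancel_left₀ _ two_ne_zero, Real.sin_arcsin (by linarith) (by linarith),
          mul_div_cancel_left₀ _ hk0.ne']
  have hinj : Set.InjOn (fun t => Real.sin (t / 2) / k) (Set.Ioo 0 θ) := by
    intro a ha b hb hab
    have : Real.sin (a / 2) = Real.sin (b / 2) := by
      simp only at hab
      field_simp at hab
      exact hab
    have := Real.injOn_sin ⟨by linarith [ha.1], by linarith [ha.2]⟩
      ⟨by linarith [hb.1], by linarith [hb.2]⟩ this
    linarith
  have hder : ∀ t ∈ Set.Ioo 0 θ, HasDerivWithinAt (fun t => Real.sin (t / 2) / k)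
      (Real.cos (t / 2) * (1 / 2) / k) (Set.Ioo 0 θ) t := by
    intro t _
    have := ((Real.hasDerivAt_sin (t / 2)).comp t ((hasDerivAt_id t).div_const 2)).div_const k
    exact this.hasDerivWithinAt
  rw [ellipticK, intervalIntegral.integral_of_le zero_le_one,
    intervalIntegral.integral_of_le h0.le, MeasureTheory.integral_Ioc_eq_integral_Ioo,
    MeasureTheory.integral_Ioc_eq_integral_Ioo, ← himage,
    MeasureTheory.integral_image_eq_integral_abs_deriv_smul measurableSet_Ioo hder hinj]
  refine MeasureTheory.setIntegral_congr_fun measurableSet_Ioo fun t ht => ?_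
  obtain ⟨hs0, hsk, hc0⟩ := hlt t ht
  simp only [smul_eq_mul]
  have e1 : 2 * Real.cos t - 2 * Real.cos θ = 2 ^ 2 * (k ^ 2 - Real.sin (t / 2) ^ 2) := by
    have a := cos_half_sq t
    have b := cos_half_sq θ
    rw [Real.cos_sq'] at a b
    linear_combination -4 * a + 4 * b
  have e2 : (1 - (Real.sin (t / 2) / k) ^ 2) * (1 - k ^ 2 * (Real.sin (t / 2) / k) ^ 2) =
      (Real.cos (t / 2) / k) ^ 2 * (k ^ 2 - Real.sin (t / 2) ^ 2) := by
    rw [div_pow, div_pow, Real.cos_sq']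
    field_simp
  have e3 : 0 < k ^ 2 - Real.sin (t / 2) ^ 2 := by nlinarith
  rw [e1, e2, Real.sqrt_mul (by positivity), Real.sqrt_mul (by positivity),
    Real.sqrt_sq (by positivity), Real.sqrt_sq (by positivity), abs_of_pos (by positivity)]
  have := Real.sqrt_pos.2 e3
  field_simp

theorem ellipticK_cos {θ : ℝ} (h0 : 0 < θ) (hπ : θ < Real.pi) :
    ellipticK (Real.cos (θ / 2)) =
      ∫ t in θ..Real.pi, 1 / √(2 * Real.cos θ - 2 * Real.cos t) := by
  have h := ellipticK_sin (θ := Real.pi - θ) (by linarith) (by linarith)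
  rw [show (Real.pi - θ) / 2 = Real.pi / 2 - θ / 2 by ring, Real.sin_pi_div_two_sub] at h
  have := intervalIntegral.integral_comp_sub_left (a := θ) (b := Real.pi)
    (fun t => 1 / √(2 * Real.cos t - 2 * Real.cos (Real.pi - θ))) Real.pi
  rw [sub_self, ← h] at this
  rw [← this]
  refine intervalIntegral.integral_congr fun t _ => ?_
  simp only [Real.cos_pi_sub]
  ring_nf

/-! ### Passing to the boundary -/

theorem intervalIntegrable_one_div_sqrt (a b : ℝ) :
    IntervalIntegrable (fun x : ℝ => 1 / √x) MeasureTheory.volume a b := by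
  have h := intervalIntegral.intervalIntegrable_rpow' (a := a) (b := b) (r := -(1 / 2))
    (by norm_num)
  refine h.congr fun x _ => ?_
  rcases le_or_gt 0 x with hx | hx
  · rw [Real.rpow_neg hx, Real.sqrt_eq_rpow]
    simp
  -- For `x < 0` both conventions give `0`: `1 / √x` because `√x = 0`, and `x ^ (-1/2)` because of a
  -- factor `cos(π/2)`.
  · rw [Real.sqrt_eq_zero_of_nonpos hx.le, Real.rpow_def_of_neg hx]
    have : -(1 / 2) * Real.pi = -(Real.pi / 2) := by ring
    rw [this, Real.cos_neg, Real.cos_pi_div_two]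
    simp

theorem abs_sin_half_le_norm {r : ℝ} (hr : 1 / 4 ≤ r) (φ : ℝ) :
    |Real.sin (φ / 2)| ≤ ‖1 - (r : ℂ) * Complex.exp (φ * Complex.I)‖ := by
  refine abs_le_of_sq_le_sq ?_ (norm_nonneg _)
  rw [← Complex.normSq_eq_norm_sq, Complex.normSq_apply]
  simp only [Complex.sub_re, Complex.one_re, Complex.re_ofReal_mul, Complex.exp_ofReal_mul_I_re,
    Complex.sub_im, Complex.one_im, Complex.im_ofReal_mul, Complex.exp_ofReal_mul_I_im]
  have h1 := Real.sin_sq_add_cos_sq φ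
  have h2 := cos_half_sq φ
  rw [Real.cos_sq'] at h2
  have h3 : Real.cos φ = 1 - 2 * Real.sin (φ / 2) ^ 2 := by linarith
  have h4 : Real.sin φ ^ 2 = 1 - Real.cos φ ^ 2 := by linarith
  have h5 : (1 - r * Real.cos φ) * (1 - r * Real.cos φ) + (0 - r * Real.sin φ) * (0 - r * Real.sin φ)
      = (1 - r) ^ 2 + 4 * r * Real.sin (φ / 2) ^ 2 := by
    have : (0 - r * Real.sin φ) * (0 - r * Real.sin φ) = r ^ 2 * (1 - Real.cos φ ^ 2) := by
      rw [← h4]; ring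
    rw [this, h3]
    ring
  rw [h5]
  nlinarith [sq_nonneg (1 - r), sq_nonneg (Real.sin (φ / 2))]

/-- An integrable bound uniform in `r`: `sin((θ+t)/2)` stays above `m` by concavity, and
`|sin((θ-t)/2)| ≥ |t - θ|/π`. Off `t = θ` exactly one of the two reciprocal roots is nonzero, so
their sum is `1/√|t - θ|`. -/
theorem exists_norm_legendreKernel_le {θ : ℝ} (h0 : 0 < θ) (hπ : θ < Real.pi) :
    ∃ C : ℝ, ∀ r : ℝ, 1 / 4 ≤ r → r ≤ 1 → ∀ t ∈ Set.Ioc 0 Real.pi, t ≠ θ →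
      ‖legendreKernel r θ t‖ ≤ C * (1 / √(t - θ) + 1 / √(θ - t)) := by
  set m := min (Real.sin (θ / 2)) (Real.sin ((θ + Real.pi) / 2)) with hm
  have hm0 : 0 < m := lt_min
    (Real.sin_pos_of_pos_of_lt_pi (by linarith) (by linarith))
    (Real.sin_pos_of_pos_of_lt_pi (by linarith) (by linarith))
  have hpi := Real.pi_pos
  refine ⟨1 / √(m / Real.pi), fun r hr hr1 t ht htθ => ?_⟩
  have hs1 : m ≤ Real.sin ((θ + t) / 2) :=
    strictConcaveOn_sin_Icc.concaveOn.min_le_of_mem_Icc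
      ⟨by linarith, by linarith⟩ ⟨by linarith, by linarith⟩
      ⟨by linarith [ht.1], by linarith [ht.2]⟩
  have hs2 : |t - θ| / Real.pi ≤ |Real.sin ((θ - t) / 2)| := by
    have hb : |(θ - t) / 2| ≤ Real.pi / 2 := by
      rw [abs_le]
      constructor <;> linarith [ht.1, ht.2]
    refine le_trans (le_of_eq ?_) (Real.mul_abs_le_abs_sin hb)
    rw [abs_div, abs_sub_comm, abs_of_pos (two_pos : (0 : ℝ) < 2)]
    field_simp
  have hr0 : 0 ≤ r := by linarith
  have hd : 0 < |t - θ| := abs_pos.2 (sub_ne_zero.2 htθ)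
  have hw : ∀ φ : ℝ, ‖psEval sqrtSeries (r * Complex.exp (φ * Complex.I))‖ ^ 2 =
      ‖1 - (r : ℂ) * Complex.exp (φ * Complex.I)‖ := fun φ =>
    norm_psEval_sqrtSeries_sq (by rw [norm_real_mul_exp hr0]; exact hr1)
  have hlow : m / Real.pi * |t - θ| ≤
      ‖psEval sqrtSeries (r * Complex.exp ((θ + t : ℝ) * Complex.I)) *
        psEval sqrtSeries (r * Complex.exp ((θ - t : ℝ) * Complex.I))‖ ^ 2 := by
    rw [norm_mul, mul_pow, hw, hw, div_mul_eq_mul_div, mul_div_assoc]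
    refine mul_le_mul ((hs1.trans (le_abs_self _)).trans (abs_sin_half_le_norm hr _))
      (hs2.trans (abs_sin_half_le_norm hr _)) (by positivity) (norm_nonneg _)
  rw [legendreKernel, norm_inv]
  have hsq := Real.sqrt_le_sqrt hlow
  rw [Real.sqrt_sq (norm_nonneg _), Real.sqrt_mul (by positivity)] at hsq
  have hp1 : 0 < √(m / Real.pi) := Real.sqrt_pos.2 (by positivity)
  have hp2 : 0 < √|t - θ| := Real.sqrt_pos.2 hd
  refine (inv_anti₀ (mul_pos hp1 hp2) hsq).trans ?_
  rw [mul_inv, one_div]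
  refine mul_le_mul_of_nonneg_left ?_ (by positivity)
  rcases lt_or_gt_of_ne htθ with h | h
  · rw [abs_of_neg (by linarith), neg_sub, ← one_div]
    exact le_add_of_nonneg_left (by positivity)
  · rw [abs_of_pos (by linarith), ← one_div]
    exact le_add_of_nonneg_right (by positivity)

theorem measurable_legendreKernel {r : ℝ} (h0 : 0 ≤ r) (h1 : r ≤ 1) (θ : ℝ) :
    Measurable (legendreKernel r θ) := by
  refine Measurable.inv (Continuous.measurable ?_)
  have hn : ∀ φ : ℝ, ‖(r : ℂ) * Complex.exp (φ * Complex.I)‖ ≤ 1 := fun φ => by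
    rwa [norm_real_mul_exp h0]
  exact (continuous_psEval_comp absSummable_sqrtSeries (by fun_prop) fun t => hn _).mul
    (continuous_psEval_comp absSummable_sqrtSeries (by fun_prop) fun t => hn _)

theorem intervalIntegrable_kernel_bound (C θ a b : ℝ) :
    IntervalIntegrable (fun t => C * (1 / √(t - θ) + 1 / √(θ - t))) MeasureTheory.volume a b := by
  refine IntervalIntegrable.const_mul (IntervalIntegrable.add ?_ ?_) C
  · have := (intervalIntegrable_one_div_sqrt (a - θ) (b - θ)).comp_sub_right θ
    simpa using this
  · have := (intervalIntegrable_one_div_sqrt (θ - a) (θ - b)).comp_sub_left θ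
    simpa using this

theorem ae_ne_volume (θ : ℝ) : ∀ᵐ t : ℝ ∂MeasureTheory.volume, t ≠ θ := by
  simp [MeasureTheory.ae_iff]

theorem intervalIntegrable_legendreKernel_one {θ : ℝ} (h0 : 0 < θ) (hπ : θ < Real.pi) :
    IntervalIntegrable (legendreKernel 1 θ) MeasureTheory.volume 0 Real.pi := by
  obtain ⟨C, hC⟩ := exists_norm_legendreKernel_le h0 hπ
  refine (intervalIntegrable_kernel_bound C θ 0 Real.pi).mono_fun'
    (measurable_legendreKernel zero_le_one le_rfl θ).aestronglyMeasurable ?_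
  rw [Filter.EventuallyLE, MeasureTheory.ae_restrict_iff' measurableSet_uIoc]
  filter_upwards [ae_ne_volume θ] with t ht hmem
  rw [Set.uIoc_of_le Real.pi_pos.le] at hmem
  exact hC 1 (by norm_num) le_rfl t hmem ht

open Filter Topology in
-- The representation inside the disc is carried to radius `1` by dominated convergence.
theorem pi_mul_legendreC_zero {θ : ℝ} (h0 : 0 < θ) (hπ : θ < Real.pi) :
    Real.pi * legendreC 0 θ = ∫ t in (0 : ℝ)..Real.pi, legendreKernel 1 θ t := by
  obtain ⟨C, hC⟩ := exists_norm_legendreKernel_le h0 hπ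
  have hsin : 0 < Real.sin θ := Real.sin_pos_of_pos_of_lt_pi h0 hπ
  have hev : ∀ᶠ r : ℝ in 𝓝[<] 1, 1 / 4 ≤ r ∧ r < 1 := by
    have h1 : ∀ᶠ r : ℝ in 𝓝[<] 1, 1 / 4 ≤ r :=
      nhdsWithin_le_nhds (Ici_mem_nhds (by norm_num))
    filter_upwards [h1, self_mem_nhdsWithin] with r a b
    exact ⟨a, b⟩
  -- The limit is taken within the closed disc, where alone the series are known to be continuous.
  have htend : ∀ φ : ℝ, Tendsto (fun r : ℝ => (r : ℂ) * Complex.exp (φ * Complex.I)) (𝓝[<] 1)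
      (𝓝[Metric.closedBall 0 1] (((1 : ℝ) : ℂ) * Complex.exp (φ * Complex.I))) := by
    intro φ
    refine tendsto_nhdsWithin_iff.2 ⟨?_, ?_⟩
    · exact ((by fun_prop : Continuous fun r : ℝ => (r : ℂ) * Complex.exp (φ * Complex.I)).tendsto
        1).mono_left nhdsWithin_le_nhds
    · filter_upwards [hev] with r hr
      rw [mem_closedBall_zero_iff, norm_real_mul_exp (by linarith [hr.1])]
      exact hr.2.le
  have hmem : ∀ φ : ℝ, ((1 : ℝ) : ℂ) * Complex.exp (φ * Complex.I) ∈
      Metric.closedBall (0 : ℂ) 1 := by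
    intro φ
    rw [mem_closedBall_zero_iff, norm_real_mul_exp zero_le_one]
  have hR : Tendsto (fun r : ℝ => ∫ t in (0 : ℝ)..Real.pi, legendreKernel r θ t) (𝓝[<] 1)
      (𝓝 (∫ t in (0 : ℝ)..Real.pi, legendreKernel 1 θ t)) := by
    refine intervalIntegral.tendsto_integral_filter_of_dominated_convergence
      (fun t => C * (1 / √(t - θ) + 1 / √(θ - t))) ?_ ?_
      (intervalIntegrable_kernel_bound C θ 0 Real.pi) ?_
    · filter_upwards [hev] with r hr
      exact (measurable_legendreKernel (by linarith [hr.1]) hr.2.le θ).aestronglyMeasurable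
    · filter_upwards [hev] with r hr
      filter_upwards [ae_ne_volume θ] with t ht hmem
      rw [Set.uIoc_of_le Real.pi_pos.le] at hmem
      exact hC r hr.1 hr.2.le t hmem ht
    · filter_upwards [ae_ne_volume θ] with t ht htm
      rw [Set.uIoc_of_le Real.pi_pos.le] at htm
      have hne : psEval sqrtSeries (((1 : ℝ) : ℂ) * Complex.exp ((θ + t : ℝ) * Complex.I)) *
          psEval sqrtSeries (((1 : ℝ) : ℂ) * Complex.exp ((θ - t : ℝ) * Complex.I)) ≠ 0 := by
        have hφ : ∀ φ : ℝ, Real.sin (φ / 2) ≠ 0 →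
            psEval sqrtSeries (((1 : ℝ) : ℂ) * Complex.exp (φ * Complex.I)) ≠ 0 := by
          intro φ hs
          refine psEval_sqrtSeries_ne_zero (by simp) fun h => ?_
          have := abs_sin_half_le_norm (r := 1) (by norm_num) φ
          rw [h, sub_self, norm_zero] at this
          exact hs (abs_nonpos_iff.1 this)
        refine mul_ne_zero (hφ _ ?_) (hφ _ ?_)
        · exact (Real.sin_pos_of_pos_of_lt_pi (by linarith [htm.1]) (by linarith [htm.2])).ne'
        · intro hs
          have := (Real.sin_eq_zero_iff_of_lt_of_lt (by linarith [htm.2]) (by linarith [htm.1])).1 hs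
          exact ht (by linarith)
      refine Tendsto.inv₀ ?_ hne
      exact (((absSummable_sqrtSeries.continuousOn _ (hmem _)).tendsto).comp (htend _)).mul
        (((absSummable_sqrtSeries.continuousOn _ (hmem _)).tendsto).comp (htend _))
  have hL : Tendsto (fun r : ℝ => (Real.pi : ℂ) *
      (psEval (legendreGSeries 0) ((r * Complex.exp (θ * Complex.I)) ^ 2) /
        (1 - (r * Complex.exp (θ * Complex.I)) ^ 2))) (𝓝[<] 1)
      (𝓝 (Real.pi * legendreC 0 θ)) := by
    refine Tendsto.const_mul _ ?_
    have hcont : ContinuousOn (fun z : ℂ => psEval (legendreGSeries 0) (z ^ 2))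
        (Metric.closedBall 0 1) := by
      refine (absSummable_legendreGSeries 0).continuousOn.comp (by fun_prop) fun z hz => ?_
      rw [mem_closedBall_zero_iff] at hz ⊢
      rw [norm_pow]
      exact pow_le_one₀ (norm_nonneg _) hz
    have h1 := ((hcont _ (hmem θ)).tendsto).comp (htend θ)
    have h2 : Tendsto (fun r : ℝ => 1 - ((r : ℂ) * Complex.exp (θ * Complex.I)) ^ 2) (𝓝[<] 1)
        (𝓝 (1 - (((1 : ℝ) : ℂ) * Complex.exp (θ * Complex.I)) ^ 2)) :=
      ((by fun_prop : Continuous fun r : ℝ =>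
        1 - ((r : ℂ) * Complex.exp (θ * Complex.I)) ^ 2).tendsto 1).mono_left nhdsWithin_le_nhds
    have h3 := h1.div h2 (by
      rw [Complex.ofReal_one, one_mul]
      exact one_sub_exp_sq_ne_zero hsin)
    rw [legendreC, pow_zero, one_mul]
    simpa [Pi.div_def, Function.comp_def] using h3
  refine tendsto_nhds_unique (hL.congr' ?_) hR
  filter_upwards [hev] with r hr
  rw [integral_legendreKernel (by linarith [hr.1]) hr.2]

/-- The pieces over `(0, θ)` and `(θ, π)` are real multiples of perpendicular unit complex numbers,
so their squares add. -/
theorem norm_legendreC_zero_sq {θ : ℝ} (h0 : 0 < θ) (hπ : θ < Real.pi) :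
    Real.pi ^ 2 * ‖legendreC 0 θ‖ ^ 2 =
      ellipticK (Real.cos (θ / 2)) ^ 2 + ellipticK (Real.sin (θ / 2)) ^ 2 := by
  have hI := pi_mul_legendreC_zero h0 hπ
  have hint := intervalIntegrable_legendreKernel_one h0 hπ
  have i1 : IntervalIntegrable (legendreKernel 1 θ) MeasureTheory.volume 0 θ :=
    hint.mono_set (by
      rw [Set.uIcc_of_le h0.le, Set.uIcc_of_le Real.pi_pos.le]
      exact Set.Icc_subset_Icc_right hπ.le)
  have i2 : IntervalIntegrable (legendreKernel 1 θ) MeasureTheory.volume θ Real.pi :=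
    hint.mono_set (by
      rw [Set.uIcc_of_le hπ.le, Set.uIcc_of_le Real.pi_pos.le]
      exact Set.Icc_subset_Icc_left h0.le)
  have e1 : ∫ t in (0 : ℝ)..θ, legendreKernel 1 θ t = (ellipticK (Real.sin (θ / 2)) : ℂ) *
      (Complex.exp ((-(θ / 2) : ℝ) * Complex.I) * Complex.I) := by
    rw [ellipticK_sin h0 hπ, ← intervalIntegral.integral_ofReal,
      ← intervalIntegral.integral_mul_const, intervalIntegral.integral_of_le h0.le,
      intervalIntegral.integral_of_le h0.le, MeasureTheory.integral_Ioc_eq_integral_Ioo,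
      MeasureTheory.integral_Ioc_eq_integral_Ioo]
    exact MeasureTheory.setIntegral_congr_fun measurableSet_Ioo fun t ht =>
      legendreKernel_one_of_lt ht.1 ht.2 hπ
  have e2 : ∫ t in θ..Real.pi, legendreKernel 1 θ t = (ellipticK (Real.cos (θ / 2)) : ℂ) *
      Complex.exp ((-(θ / 2) : ℝ) * Complex.I) := by
    rw [ellipticK_cos h0 hπ, ← intervalIntegral.integral_ofReal,
      ← intervalIntegral.integral_mul_const, intervalIntegral.integral_of_le hπ.le,
      intervalIntegral.integral_of_le hπ.le, MeasureTheory.integral_Ioc_eq_integral_Ioo,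
      MeasureTheory.integral_Ioc_eq_integral_Ioo]
    exact MeasureTheory.setIntegral_congr_fun measurableSet_Ioo fun t ht =>
      legendreKernel_one_of_gt h0 ht.1 ht.2
  rw [← intervalIntegral.integral_add_adjacent_intervals i1 i2, e1, e2] at hI
  have hz : (Real.pi : ℂ) * legendreC 0 θ =
      ((ellipticK (Real.cos (θ / 2)) : ℂ) + (ellipticK (Real.sin (θ / 2)) : ℂ) * Complex.I) *
        Complex.exp ((-(θ / 2) : ℝ) * Complex.I) := by
    rw [hI]
    ring
  have := congrArg (fun z : ℂ => ‖z‖ ^ 2) hz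
  simp only [norm_mul, mul_pow, Complex.norm_exp_ofReal_mul_I, mul_one] at this
  rw [Complex.norm_real, Real.norm_of_nonneg Real.pi_pos.le, ← Complex.normSq_eq_norm_sq (_ + _),
    Complex.normSq_add_mul_I] at this
  exact this

/-! ### The weight function -/

theorem legendreWeight_neg (x : ℝ) : legendreWeight (-x) = legendreWeight x := by
  rw [legendreWeight, legendreWeight, add_comm]
  congr 1
  ring_nf

theorem legendreWeight_two_cos {θ : ℝ} (h0 : 0 < θ) (hπ : θ < Real.pi) :
    legendreWeight (2 * Real.cos θ) =
      2 / Real.pi ^ 2 * ‖psEval legendreVSeries (Complex.exp (θ * Complex.I) ^ 2)‖ ^ 2 := by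
  have hsin : 0 < Real.sin θ := Real.sin_pos_of_pos_of_lt_pi h0 hπ
  have h1 : √(1 / 2 + 2 * Real.cos θ / 4) = Real.cos (θ / 2) := by
    rw [show 1 / 2 + 2 * Real.cos θ / 4 = Real.cos (θ / 2) ^ 2 by
      rw [cos_half_sq]; ring]
    exact Real.sqrt_sq (Real.cos_nonneg_of_mem_Icc ⟨by linarith, by linarith⟩)
  have h2 : √(1 / 2 - 2 * Real.cos θ / 4) = Real.sin (θ / 2) := by
    rw [show 1 / 2 - 2 * Real.cos θ / 4 = Real.sin (θ / 2) ^ 2 by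
      rw [Real.sin_sq, cos_half_sq]; ring]
    exact Real.sqrt_sq (Real.sin_nonneg_of_nonneg_of_le_pi (by linarith) (by linarith))
  have hV := congrArg norm (legendreV_mul_legendreC_zero hsin)
  rw [norm_mul, norm_one] at hV
  rw [legendreWeight, h1, h2, ← norm_legendreC_zero_sq h0 hπ, eq_inv_of_mul_eq_one_left hV]
  field_simp

theorem legendreV_ne_zero {θ : ℝ} (h : 0 < Real.sin θ) :
    psEval legendreVSeries (Complex.exp (θ * Complex.I) ^ 2) ≠ 0 :=
  left_ne_zero_of_mul_eq_one (legendreV_mul_legendreC_zero h)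

theorem exists_two_cos_eq {x : ℝ} (hx : x ∈ Set.Ioo (-2 : ℝ) 2) :
    ∃ θ ∈ Set.Ioo 0 Real.pi, 2 * Real.cos θ = x := by
  refine ⟨Real.arccos (x / 2), ⟨?_, ?_⟩, ?_⟩
  · exact Real.arccos_pos.2 (by linarith [hx.2])
  · refine lt_of_le_of_ne (Real.arccos_le_pi _) fun h => ?_
    have := Real.arccos_eq_pi.1 h
    linarith [hx.1]
  · rw [Real.cos_arccos (by linarith [hx.1]) (by linarith [hx.2])]
    ring

theorem legendreWeight_pos {x : ℝ} (hx : x ∈ Set.Ioo (-2 : ℝ) 2) : 0 < legendreWeight x := by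
  obtain ⟨θ, hθ, rfl⟩ := exists_two_cos_eq hx
  rw [legendreWeight_two_cos hθ.1 hθ.2]
  have := norm_pos_iff.2 (legendreV_ne_zero (Real.sin_pos_of_pos_of_lt_pi hθ.1 hθ.2))
  have := Real.pi_pos
  positivity

theorem image_two_cos : (fun θ => 2 * Real.cos θ) '' Set.Ioo 0 Real.pi = Set.Ioo (-2) 2 := by
  ext x
  constructor
  · rintro ⟨θ, hθ, rfl⟩
    have h1 := Real.cos_lt_cos_of_nonneg_of_le_pi le_rfl hθ.2.le hθ.1
    have h2 := Real.cos_lt_cos_of_nonneg_of_le_pi hθ.1.le le_rfl hθ.2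
    rw [Real.cos_zero] at h1
    rw [Real.cos_pi] at h2
    exact ⟨by simp only; linarith, by simp only; linarith⟩
  · intro hx
    exact exists_two_cos_eq hx

theorem injOn_two_cos : Set.InjOn (fun θ => 2 * Real.cos θ) (Set.Ioo 0 Real.pi) := by
  intro a ha b hb hab
  refine Real.injOn_cos (Set.Ioo_subset_Icc_self ha) (Set.Ioo_subset_Icc_self hb) ?_
  simpa using hab

theorem hasDerivWithinAt_two_cos (θ : ℝ) : HasDerivWithinAt (fun θ => 2 * Real.cos θ)
    (2 * -Real.sin θ) (Set.Ioo 0 Real.pi) θ :=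
  ((Real.hasDerivAt_cos θ).const_mul 2).hasDerivWithinAt

theorem weighted_change_of_variables (p : ℝ[X]) {θ : ℝ} (hθ : θ ∈ Set.Ioo 0 Real.pi) :
    |2 * -Real.sin θ| • (p.eval (2 * Real.cos θ) * legendreWeight (2 * Real.cos θ)) =
      4 / Real.pi ^ 2 * (p.eval (2 * Real.cos θ) *
        ‖psEval legendreVSeries (Complex.exp (θ * Complex.I) ^ 2)‖ ^ 2 * Real.sin θ) := by
  have hsin : 0 < Real.sin θ := Real.sin_pos_of_pos_of_lt_pi hθ.1 hθ.2
  rw [legendreWeight_two_cos hθ.1 hθ.2, mul_neg, abs_neg, abs_of_pos (by positivity), smul_eq_mul]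
  ring

/-- After `x = 2 cos θ` the integrand extends continuously to `[0, π]`, since `V` is continuous on
the closed disc; no asymptotics of `K` at the endpoints are needed. -/
theorem intervalIntegrable_mul_legendreWeight (p : ℝ[X]) :
    IntervalIntegrable (fun x => p.eval x * legendreWeight x) MeasureTheory.volume (-2) 2 := by
  rw [intervalIntegrable_iff_integrableOn_Ioo_of_le (by norm_num), ← image_two_cos,
    MeasureTheory.integrableOn_image_iff_integrableOn_abs_deriv_smul measurableSet_Ioo
      (fun θ _ => hasDerivWithinAt_two_cos θ) injOn_two_cos,
    MeasureTheory.integrableOn_congr_fun (fun θ hθ => weighted_change_of_variables p hθ)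
      measurableSet_Ioo]
  refine (Continuous.integrableOn_Icc (a := 0) (b := Real.pi) ?_).mono_set Set.Ioo_subset_Icc_self
  have h1 := continuous_psEval_exp_sq absSummable_legendreVSeries
  have h2 : Continuous fun θ : ℝ => p.eval (2 * Real.cos θ) :=
    p.continuous.comp (by fun_prop)
  exact continuous_const.mul ((h2.mul (h1.norm.pow 2)).mul Real.continuous_sin)

theorem integral_mul_legendreWeight (p : ℝ[X]) :
    ∫ x in (-2 : ℝ)..2, p.eval x * legendreWeight x =
      4 / Real.pi ^ 2 * ∫ θ in (0 : ℝ)..Real.pi, (p.eval (2 * Real.cos θ) *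
        ‖psEval legendreVSeries (Complex.exp (θ * Complex.I) ^ 2)‖ ^ 2 * Real.sin θ) := by
  rw [intervalIntegral.integral_of_le (by norm_num), intervalIntegral.integral_of_le Real.pi_pos.le,
    MeasureTheory.integral_Ioc_eq_integral_Ioo, MeasureTheory.integral_Ioc_eq_integral_Ioo,
    ← image_two_cos, MeasureTheory.integral_image_eq_integral_abs_deriv_smul measurableSet_Ioo
      (fun θ _ => hasDerivWithinAt_two_cos θ) injOn_two_cos,
    ← MeasureTheory.integral_const_mul]
  exact MeasureTheory.setIntegral_congr_fun measurableSet_Ioo fun θ hθ =>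
    weighted_change_of_variables p hθ

theorem integral_mul_legendreWeight_eq_zero {S : ℕ → ℝ[X]}
    (hS : IsSymmetricRecurrence
      (fun n => ((n : ℝ) + 1 / 2) ^ 2 / ((n : ℝ) * ((n : ℝ) + 1))) S) (n : ℕ) :
    ∫ x in (-2 : ℝ)..2, (S (n + 1)).eval x * legendreWeight x = 0 := by
  have h := integral_re_legendre_boundary (n + 1) (by omega)
  rw [intervalIntegral.integral_of_le Real.pi_pos.le, MeasureTheory.integral_Ioc_eq_integral_Ioo,
    MeasureTheory.setIntegral_congr_fun measurableSet_Ioo fun θ hθ =>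
      re_legendre_boundary hS (n + 1) (Real.sin_pos_of_pos_of_lt_pi hθ.1 hθ.2),
    MeasureTheory.integral_const_mul] at h
  have hne : 2 / Real.pi * hermiteXi (n + 1) ≠ 0 :=
    mul_ne_zero (by positivity) (hermiteXi_pos _).ne'
  rw [integral_mul_legendreWeight, intervalIntegral.integral_of_le Real.pi_pos.le,
    MeasureTheory.integral_Ioc_eq_integral_Ioo, (mul_eq_zero.1 h).resolve_left hne, mul_zero]

/-! ### Orthogonality from the three-term recurrence -/

theorem IsSymmetricRecurrence.X_mul {u : ℕ → ℝ} {S : ℕ → ℝ[X]} (hS : IsSymmetricRecurrence u S)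
    (n : ℕ) : X * S (n + 1) = S (n + 2) + C (u (n + 1)) * S n := (hS.rec_succ n).symm

/-- Symmetry of multiplication by `X` moves degree from the left factor to the right one. In every
product so produced the left index is smaller and still below the right, down to `L (S n) = 0`. -/
theorem IsSymmetricRecurrence.functional_eq_zero {u : ℕ → ℝ} {S : ℕ → ℝ[X]}
    (hS : IsSymmetricRecurrence u S) {L : ℝ[X] →ₗ[ℝ] ℝ} (hL : ∀ n, L (S (n + 1)) = 0) (m : ℕ) :
    ∀ n, m < n → L (S m * S n) = 0 := by
  have hC : ∀ (c : ℝ) (p : ℝ[X]), L (C c * p) = c * L p := fun c p => by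
    rw [← smul_eq_C_mul, map_smul, smul_eq_mul]
  induction m using Nat.strong_induction_on with
  | _ m ih =>
    intro n hn
    match m with
    | 0 =>
      obtain ⟨k, rfl⟩ : ∃ k, n = k + 1 := ⟨n - 1, by omega⟩
      rw [hS.init, one_mul, hL]
    | 1 =>
      obtain ⟨k, rfl⟩ : ∃ k, n = k + 2 := ⟨n - 2, by omega⟩
      rw [hS.rec_zero, hS.init, mul_one, hS.X_mul, map_add, hC, hL, hL, mul_zero, add_zero]
    | m + 2 =>
      obtain ⟨k, rfl⟩ : ∃ k, n = k + 1 := ⟨n - 1, by omega⟩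
      have h1 : S (m + 2) * S (k + 1) = S (m + 1) * S (k + 2) +
          C (u (k + 1)) * (S (m + 1) * S k) - C (u (m + 1)) * (S m * S (k + 1)) := by
        linear_combination S (k + 1) * hS.rec_succ m - S (m + 1) * hS.rec_succ k
      rw [h1, map_sub, map_add, hC, hC, ih (m + 1) (by omega) _ (by omega),
        ih (m + 1) (by omega) _ (by omega), ih m (by omega) _ (by omega)]
      simp

/-- Integration against the weight, as a linear functional on polynomials. -/
def legendreFunctional : ℝ[X] →ₗ[ℝ] ℝ where
  toFun p := ∫ x in (-2 : ℝ)..2, p.eval x * legendreWeight x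
  map_add' p q := by
    simp only [eval_add, add_mul]
    exact intervalIntegral.integral_add (intervalIntegrable_mul_legendreWeight p)
      (intervalIntegrable_mul_legendreWeight q)
  map_smul' c p := by
    simp only [eval_smul, smul_eq_mul, mul_assoc, RingHom.id_apply]
    exact intervalIntegral.integral_const_mul _ _

/-- The integrand is positive off the finite set of roots of `p`. -/
theorem integral_sq_mul_legendreWeight_pos {p : ℝ[X]} (hp : p ≠ 0) :
    0 < ∫ x in (-2 : ℝ)..2, (p * p).eval x * legendreWeight x := by
  have hnn : ∀ x ∈ Set.Ioo (-2 : ℝ) 2, 0 ≤ (p * p).eval x * legendreWeight x := fun x hx => by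
    rw [eval_mul]
    exact mul_nonneg (mul_self_nonneg _) (legendreWeight_pos hx).le
  have hi := (intervalIntegrable_iff_integrableOn_Ioo_of_le (by norm_num)).1
    (intervalIntegrable_mul_legendreWeight (p * p))
  rw [intervalIntegral.integral_of_le (by norm_num), MeasureTheory.integral_Ioc_eq_integral_Ioo,
    MeasureTheory.setIntegral_pos_iff_support_of_nonneg_ae
      ((MeasureTheory.ae_restrict_iff' measurableSet_Ioo).2 (Filter.Eventually.of_forall hnn)) hi]
  have hsub : Set.Ioo (-2 : ℝ) 2 \ p.rootSet ℝ ⊆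
      Function.support (fun x => (p * p).eval x * legendreWeight x) ∩ Set.Ioo (-2) 2 := by
    rintro x ⟨hx, hxr⟩
    refine ⟨?_, hx⟩
    rw [Function.mem_support, eval_mul]
    have : p.eval x ≠ 0 := fun h => hxr ((mem_rootSet_of_ne hp).2 (by simpa using h))
    exact mul_ne_zero (mul_self_ne_zero.2 this) (legendreWeight_pos hx).ne'
  refine lt_of_lt_of_le ?_ (MeasureTheory.measure_mono hsub)
  rw [MeasureTheory.measure_sdiff_null ((p.rootSet_finite ℝ).measure_zero _), Real.volume_Ioo]
  norm_num

theorem isOrthogonalOn_legendreWeight {S : ℕ → ℝ[X]}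
    (hS : IsSymmetricRecurrence
      (fun n => ((n : ℝ) + 1 / 2) ^ 2 / ((n : ℝ) * ((n : ℝ) + 1))) S)
    (hne : ∀ n, S n ≠ 0) : IsOrthogonalOn S legendreWeight := by
  have hz := hS.functional_eq_zero (L := legendreFunctional)
    (fun n => integral_mul_legendreWeight_eq_zero hS n)
  have hmul : ∀ n m, (fun x => (S n).eval x * (S m).eval x * legendreWeight x) =
      fun x => (S n * S m).eval x * legendreWeight x := fun n m => by
    funext x
    rw [eval_mul]
  refine ⟨fun n m => ?_, fun n => legendreFunctional (S n * S n),
    fun n => integral_sq_mul_legendreWeight_pos (hne n), fun n m => ?_⟩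
  · rw [hmul]
    exact intervalIntegrable_mul_legendreWeight _
  · rw [hmul]
    change legendreFunctional (S n * S m) = _
    rcases lt_trichotomy n m with h | rfl | h
    · rw [if_neg h.ne, hz n m h]
    · rw [if_pos rfl]
    · rw [if_neg h.ne', mul_comm, hz m n h]

end

/-! ### Assembly of the theorem. -/

theorem mainTheorem6 :
    -- an arbitrary LBP: reciprocal invariance, and the polynomials `S_n` when `d_n ≡ -1`
    (∀ (d b : ℕ → ℂ) (P : ℕ → ℂ[X]), IsLBP d b P →
      (IsReciprocalInvariant P ↔ ∀ n, d n = -1) ∧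
      ((∀ n, d n = -1) →
        ∃ S : ℕ → ℂ[X], IsSymmetrization P S ∧ (∀ T, IsSymmetrization P T → T = S) ∧
          (∀ n, (S n).Monic ∧ (S n).natDegree = n) ∧
          IsSymmetricRecurrence (fun n => -b n) S)) ∧
    -- the Hermite elliptic LBP
    IsLBP (fun _ => (-1 : ℝ)) (fun n => -(((n : ℝ) + 1 / 2) ^ 2 / ((n : ℝ) * ((n : ℝ) + 1))))
      hermiteP ∧
    IsReciprocalInvariant hermiteP ∧
    (∀ n, (hermiteP n).eval 1 ≠ 0) ∧
    ∃ S : ℕ → ℝ[X], IsSymmetrization hermiteP S ∧ (∀ T, IsSymmetrization hermiteP T → T = S) ∧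
      (∀ n, (S n).Monic ∧ (S n).natDegree = n) ∧
      -- agreement with the polynomials built from the Szegő polynomials
      (∀ (n : ℕ) (a : ℝ), a = -(christoffelOne hermiteP n).eval 0 →
        1 - a ≠ 0 ∧ ∀ z s : ℂ, z ≠ 0 → s ^ 2 = z →
          aeval (s + s⁻¹) (S n) =
            s⁻¹ ^ n * (aeval z (christoffelOne hermiteP n)
              + z ^ n * aeval (1 / z) (christoffelOne hermiteP n)) / ((1 - a : ℝ) : ℂ)) ∧
      IsSymmetricRecurrence (fun n => ((n : ℝ) + 1 / 2) ^ 2 / ((n : ℝ) * ((n : ℝ) + 1))) S ∧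
      S = assocLegendre (1 / 2) ∧
      (∀ (n : ℕ) (x : ℝ), (S n).eval (-x) = (-1) ^ n * (S n).eval x) ∧
      (∀ x : ℝ, x ∈ Set.Ioo (-2) 2 → 0 < legendreWeight x) ∧
      (∀ x : ℝ, legendreWeight (-x) = legendreWeight x) ∧
      IsOrthogonalOn S legendreWeight := by
  have hL := isLBP_hermiteP
  have hsym := hL.isSymmetrization fun _ => rfl
  have hrec := isSymmetricRecurrence_symmetrization (R := ℝ)
    fun n => -(((n : ℝ) + 1 / 2) ^ 2 / ((n : ℝ) * ((n : ℝ) + 1)))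
  simp only [neg_neg] at hrec
  have hmon := symmetrization_monic_natDegree (R := ℝ)
    fun n => -(((n : ℝ) + 1 / 2) ^ 2 / ((n : ℝ) * ((n : ℝ) + 1)))
  have hinv := hsym.isReciprocalInvariant
  have h0 : ∀ n, (hermiteP n).eval 0 = 1 := by
    intro n
    induction n with
    | zero => simp [hL.init]
    | succ n ih => rw [hL.eval_zero_succ, ih]; norm_num
  refine ⟨fun d b P hP => ⟨⟨fun h n => hP.coeff_eq_neg_one h n, fun h =>
      (hP.isSymmetrization h).isReciprocalInvariant⟩, fun h =>
      ⟨symmetrization b, hP.isSymmetrization h, fun T hT => hT.unique (hP.isSymmetrization h),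
        symmetrization_monic_natDegree b, isSymmetricRecurrence_symmetrization b⟩⟩,
    hL, hinv, eval_one_hermiteP_ne_zero, symmetrization _, hsym, fun T hT => hT.unique hsym, hmon,
    ?_, hrec, eq_assocLegendre_of_recurrence (fun n => ?_) hrec, hrec.eval_neg,
    fun x hx => legendreWeight_pos hx, legendreWeight_neg,
    isOrthogonalOn_legendreWeight hrec fun n => (hmon n).1.ne_zero⟩
  · rintro n a rfl
    have hP1 := eval_one_hermiteP_ne_zero n
    -- As `P_n(0) = P_{n+1}(0) = 1`, the value of the transform at `0` is `U_n - 1`.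
    have ha : 1 - -(christoffelOne hermiteP n).eval 0 =
        (hermiteP (n + 1)).eval 1 / (hermiteP n).eval 1 := by
      rw [eval_zero_christoffelOne hermiteP n hP1 (h0 n) (h0 (n + 1))]
      ring
    have hU : (hermiteP (n + 1)).eval 1 / (hermiteP n).eval 1 ≠ 0 :=
      div_ne_zero (eval_one_hermiteP_ne_zero (n + 1)) hP1
    rw [ha]
    refine ⟨hU, fun z s hz hs => ?_⟩
    rw [christoffelOne_add_reciprocal hermiteP hinv n hP1 z hz, hsym n z s hz hs,
      eq_div_iff (Complex.ofReal_ne_zero.2 hU)]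
    ring
  -- With `N = n + 1`, `(N + 1/2)² - 1/4 = N(N + 1)`.
  · push_cast
    congr 1
    ring
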